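/- **Theorem 2.8.** Let $\mathbb{K}$ be a field and let $Ch_{\mathbb{K}}$ be the category of $\mathbb{Z}$-graded chain complexes over $\mathbb{K}$ (differentials of degree $-1$), with the usual Koszul sign rules. *Definitions.* A dg prop $P$ is a family of chain complexes $P(m,n)$, $m,n\in\mathbb{N}$ (operations with $m$ inputs and $n$ outputs), with a right action of $\Sigma_m$ and a commuting left action of $\Sigma_n$, associative horizontal products $\circ_h:P(m_1,n_1)\otimes P(m_2,n_2)\to P(m_1+m_2,n_1+n_2)$, associative vertical products $\circ_v:P(k,n)\otimes P(m,k)\to P(m,n)$, and units $1_n\in P(n,n)$, satisfying the unit axioms, the exchange law, and compatibility with the actions of the symmetric groups (including the commutation of $\circ_h$ with block permutations); equivalently, a strict symmetric monoidal dg category with object set $\mathbb{N}$ whose symmetries are the permutations. Morphisms of dg props are families of chain maps preserving all of this structure. A morphism of dg props is an acyclic fibration if each of its components is a surjective quasi-isomorphism, and $P$ is cofibrant if every morphism $P\to R$ lifts through every acyclic fibration $Q\to R$ of dg props. The endomorphism prop of a chain complex $X$ is $End_X(m,n)=Hom(X^{\otimes m},X^{\otimes n})$ (internal hom). A $P$-algebra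 is a chain complex $X$ with a morphism of props $P\to End_X$, and a morphism of $P$-algebras is a chain map commuting with the action of all operations; they form the category $Ch_{\mathbb{K}}^P$. *The factorization of chain maps.* For a chain map $f:X\to Y$ let $$Z(f)=\mathbb{K}e_0\otimes X\;\oplus\;\mathbb{K}e_{01}\otimes Y\;\oplus\;\mathbb{K}e_1\otimes Y,\qquad \deg e_0=\deg e_1=0,\ \deg e_{01}=-1,$$ so that $Z(f)_k=X_k\oplus Y_{k+1}\oplus Y_k$, with differential $d(x,y',y)=(dx,\;f(x)-dy'-y,\;dy)$. Let $i:X\to Z(f)$, $i(x)=(x,0,f(x))$, let $p:Z(f)\to Y$, $p(x,y',y)=y$, and let $s:Z(f)\to X$, $s(x,y',y)=x$. These are chain maps, natural in the arrow $f$, with $p\,i=f$ and $s\,i=\mathrm{id}_X$. *Statement.* Let $P$ be a cofibrant dg prop. Then the functorial factorization $X\xrightarrow{\,i\,}Z(f)\xrightarrow{\,p\,}Y$ lifts to a functorial factorization of morphisms of $P$-algebras into an acyclic injection (an injective quasi-isomorphism) followed by a surjection. That is, there are a functor $\widetilde Z$ from the category of arrows of $Ch_{\mathbb{K}}^P$ to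 $Ch_{\mathbb{K}}^P$ and natural transformations $\tilde\imath$ from the source functor to $\widetilde Z$ and $\tilde p$ from $\widetilde Z$ to the target functor such that, for every morphism $f:X\to Y$ of $P$-algebras, $\tilde p_f\,\tilde\imath_f=f$, $\tilde\imath_f$ is an acyclic injection and $\tilde p_f$ is a surjection, and such that the functor and the natural transformations underlying $\widetilde Z,\tilde\imath,\tilde p$ on chain complexes are exactly $Z,i,p$. Moreover, if $P$ has no non-zero operation with inputs and without outputs (i.e. $P(m,0)=0$ for all $m\geq 1$), then $\widetilde Z,\tilde\imath,\tilde p$ can be chosen so that $s$ also lifts to a natural transformation from $\widetilde Z$ to the source functor (i.e. $s$ is a morphism of $P$-algebras). -/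

import Mathlib

universe u
open CategoryTheory TensorProduct

namespace DG

section Chain
variable {K : Type u} [Field K]

/-- `ℤ`-graded chain complexes over `K`; differentials lower the degree by one. -/
abbrev Ch (K : Type u) [Field K] := ChainComplex (ModuleCat.{u} K) ℤ

/-- A sign, as a scalar of `K`. -/
def sg (K : Type u) [Field K] (c : ℤˣ) : K := ((c : ℤ) : K)

/-- The direct sum of the components of a chain complex. -/
def Tot (X : Ch K) : Type u := DirectSum ℤ fun i => X.X i

noncomputable instance (X : Ch K) : AddCommGroup (Tot X) :=
  inferInstanceAs (AddCommGroup (DirectSum ℤ fun i => X.X i))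

noncomputable instance (X : Ch K) : Module K (Tot X) :=
  inferInstanceAs (Module K (DirectSum ℤ fun i => X.X i))

/-- The inclusion of the component of degree `i`. -/
noncomputable def tin (X : Ch K) (i : ℤ) : X.X i →ₗ[K] Tot X :=
  DirectSum.lof K ℤ (fun i => X.X i) i

/-- The linear map on the total module given by linear maps on the components. -/
noncomputable def totDesc (X : Ch K) {M : Type*} [AddCommGroup M] [Module K M]
    (φ : ∀ i, X.X i →ₗ[K] M) : Tot X →ₗ[K] M :=
  DirectSum.toModule K ℤ M φ

/-- The differential on the total module. -/
noncomputable def totD (X : Ch K) : Tot X →ₗ[K] Tot X :=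
  totDesc X fun i => tin X (i - 1) ∘ₗ (X.d i (i - 1)).hom

/-- The map `x ↦ (-1) ^ (|x| * k) x` on homogeneous elements. -/
noncomputable def totSign (X : Ch K) (k : ℤ) : Tot X →ₗ[K] Tot X :=
  totDesc X fun i => sg K (i * k).negOnePow • tin X i

/-- The projection on the components of even (`e = 0`) or odd (`e = 1`) degree. -/
noncomputable def totParity (X : Ch K) (e : Fin 2) : Tot X →ₗ[K] Tot X :=
  totDesc X fun i => if i % 2 = (e.val : ℤ) then tin X i else 0

/-- The map of total modules induced by a chain map. -/
noncomputable def totMap {X Y : Ch K} (f : X ⟶ Y) : Tot X →ₗ[K] Tot Y :=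
  totDesc X fun i => tin Y i ∘ₗ (f.f i).hom

/-- The tensor power `X^{⊗ n}`. -/
abbrev TP (X : Ch K) (n : ℕ) : Type u := PiTensorProduct K fun _ : Fin n => Tot X

/-- The elements of the total module that are homogeneous of degree `i`. -/
noncomputable def totDeg (X : Ch K) (i : ℤ) : Submodule K (Tot X) := LinearMap.range (tin X i)

/-- The component of degree `k` of `X^{⊗ n}`, spanned by the tensors `y₁ ⊗ ⋯ ⊗ yₙ` of homogeneous
elements of degrees `a₁, …, aₙ` with `a₁ + ⋯ + aₙ = k`. -/
noncomputable def tpDeg (X : Ch K) (n : ℕ) (k : ℤ) : Submodule K (TP X n) :=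
  Submodule.span K {t | ∃ (a : Fin n → ℤ) (y : Fin n → Tot X),
    ∑ j, a j = k ∧ (∀ j, y j ∈ totDeg X (a j)) ∧ PiTensorProduct.tprod K y = t}

/-- The differential of `X^{⊗ n}`, with the usual Koszul signs:
`d (x₁ ⊗ ⋯ ⊗ xₙ) = ∑ j, (-1) ^ (|x₁| + ⋯ + |xⱼ₋₁|) x₁ ⊗ ⋯ ⊗ d xⱼ ⊗ ⋯ ⊗ xₙ`. -/
noncomputable def tpD (X : Ch K) (n : ℕ) : TP X n →ₗ[K] TP X n :=
  ∑ j : Fin n, PiTensorProduct.map fun i =>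
    if i < j then totSign X 1 else if i = j then totD X else LinearMap.id

/-- The map `t ↦ (-1) ^ (|t| * k) t` on `X^{⊗ n}`. -/
noncomputable def tpSign (X : Ch K) (n : ℕ) (k : ℤ) : TP X n →ₗ[K] TP X n :=
  PiTensorProduct.map fun _ => totSign X k

/-- The map `f^{⊗ n}`, for `f` a chain map (of degree `0`, hence without signs). -/
noncomputable def tpMap {X Y : Ch K} (f : X ⟶ Y) (n : ℕ) : TP X n →ₗ[K] TP Y n :=
  PiTensorProduct.map fun _ => totMap f

/-- The Koszul sign of a permutation `σ` of homogeneous factors of degrees `a j`: the product of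
`(-1) ^ (a i * a j)` over the pairs `i < j` whose order is reversed by `σ`. -/
def koszul {n : ℕ} (σ : Equiv.Perm (Fin n)) (a : Fin n → ℤ) : ℤˣ :=
  ∏ i, ∏ j, if i < j ∧ σ j < σ i then (a i * a j).negOnePow else 1

/-- The left action of a permutation on `X^{⊗ n}`: it moves the factor at the place `j` to the
place `σ j`, with the Koszul sign (which only depends on the parities `e` of the degrees). -/
noncomputable def tpPerm (X : Ch K) {n : ℕ} (σ : Equiv.Perm (Fin n)) : TP X n →ₗ[K] TP X n :=
  ∑ e : Fin n → Fin 2, sg K (koszul σ fun j => ((e j).val : ℤ)) •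
    ((PiTensorProduct.reindex K (fun _ => Tot X) σ).toLinearMap ∘ₗ
      PiTensorProduct.map fun j => totParity X (e j))

/-- The identification of `Fin m` with the concatenation of `Fin m₁` and `Fin m₂`. -/
def blockEquiv {m₁ m₂ m : ℕ} (h : m₁ + m₂ = m) : Fin m₁ ⊕ Fin m₂ ≃ Fin m :=
  finSumFinEquiv.trans (finCongr h)

/-- The block sum `σ ⊕ τ` of permutations. -/
def blockSum {m₁ m₂ m : ℕ} (h : m₁ + m₂ = m) (σ : Equiv.Perm (Fin m₁))
    (τ : Equiv.Perm (Fin m₂)) : Equiv.Perm (Fin m) :=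
  (blockEquiv h).permCongr (Equiv.sumCongr σ τ)

/-- The permutation that exchanges the block of the first `m₁` letters with that of the last
`m₂` letters. -/
def blockSwap {m₁ m₂ m : ℕ} (h : m₁ + m₂ = m) : Equiv.Perm (Fin m) :=
  (blockEquiv h).symm.trans ((Equiv.sumComm _ _).trans (blockEquiv ((Nat.add_comm _ _).trans h)))

/-- The concatenation `X^{⊗ m₁} ⊗ X^{⊗ m₂} ≃ X^{⊗ m}`, for `m₁ + m₂ = m`. -/
noncomputable def tpJoinEquiv (X : Ch K) {m₁ m₂ m : ℕ} (h : m₁ + m₂ = m) :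
    (TP X m₁ ⊗[K] TP X m₂) ≃ₗ[K] TP X m :=
  (PiTensorProduct.tmulEquiv K (Tot X)).trans
    (PiTensorProduct.reindex K (fun _ => Tot X) (blockEquiv h))

/-- The concatenation of tensors. -/
noncomputable def tpJoin (X : Ch K) {m₁ m₂ m : ℕ} (h : m₁ + m₂ = m)
    (u : TP X m₁) (v : TP X m₂) : TP X m :=
  tpJoinEquiv X h (u ⊗ₜ v)

section Lemmas

variable {X Y : Ch K}

theorem sg_one : sg K 1 = 1 := by simp [sg]

theorem sg_mul (c c' : ℤˣ) : sg K (c * c') = sg K c * sg K c' := by simp [sg]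

theorem sg_neg (c : ℤˣ) : sg K (-c) = -sg K c := by simp [sg]

theorem sg_smul_sg {M : Type*} [AddCommMonoid M] [Module K M] (c c' : ℤˣ) (t : M) :
    sg K c • sg K c' • t = sg K (c * c') • t := by rw [sg_mul, mul_smul]

theorem negOnePow_mul_self_eq_one (i : ℤ) : i.negOnePow * i.negOnePow = 1 := by
  rw [← Int.negOnePow_add, Int.negOnePow_even _ ⟨i, rfl⟩]

theorem totDesc_tin {M : Type*} [AddCommGroup M] [Module K M] (φ : ∀ i, X.X i →ₗ[K] M) (i : ℤ)
    (x : X.X i) : totDesc X φ (tin X i x) = φ i x := by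
  have := DirectSum.toModule_lof K (M := fun i => X.X i) (φ := φ) i x
  exact this

theorem tot_ext {M : Type*} [AddCommGroup M] [Module K M] {φ ψ : Tot X →ₗ[K] M}
    (h : ∀ i (x : X.X i), φ (tin X i x) = ψ (tin X i x)) : φ = ψ :=
  DirectSum.linearMap_ext K fun i => LinearMap.ext fun x => h i x

theorem totSign_of_mem {i : ℤ} (k : ℤ) {y : Tot X} (hy : y ∈ totDeg X i) :
    totSign X k y = sg K (i * k).negOnePow • y := by
  obtain ⟨x, rfl⟩ := hy
  simp [totSign, totDesc_tin]

theorem totD_tin (i j : ℤ) (h : j + 1 = i) (x : X.X i) :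
    totD X (tin X i x) = tin X j ((X.d i j).hom x) := by
  obtain rfl : j = i - 1 := by omega
  simp [totD, totDesc_tin]

theorem totD_mem {i j : ℤ} (h : j + 1 = i) {y : Tot X} (hy : y ∈ totDeg X i) :
    totD X y ∈ totDeg X j := by
  obtain ⟨x, rfl⟩ := hy
  exact ⟨_, (totD_tin i j h x).symm⟩

theorem totD_totD (y : Tot X) : totD X (totD X y) = 0 := by
  have : totD X ∘ₗ totD X = 0 := by
    refine tot_ext fun i x => ?_
    have h := congrArg (fun f => f.hom x) (X.d_comp_d i (i - 1) (i - 1 - 1))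
    simp only [ModuleCat.hom_comp, LinearMap.comp_apply] at h
    change totD X (totD X (tin X i x)) = 0
    rw [totD_tin i (i - 1) (by omega), totD_tin (i - 1) (i - 1 - 1) (by omega), h]
    simp
  exact LinearMap.congr_fun this y

theorem totParity_of_mem {i : ℤ} (e : Fin 2) {y : Tot X} (hy : y ∈ totDeg X i) :
    totParity X e y = if i % 2 = (e.val : ℤ) then y else 0 := by
  obtain ⟨x, rfl⟩ := hy
  simp only [totParity, totDesc_tin]
  split_ifs <;> rfl

theorem totSign_mem {i : ℤ} (k : ℤ) {y : Tot X} (hy : y ∈ totDeg X i) :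
    totSign X k y ∈ totDeg X i := by
  rw [totSign_of_mem k hy]
  exact Submodule.smul_mem _ _ hy

/-- Linear maps on a tensor power are determined by the tensors of homogeneous elements. -/
theorem tp_ext {n : ℕ} {M : Type*} [AddCommGroup M] [Module K M] {φ ψ : TP X n →ₗ[K] M}
    (h : ∀ (a : Fin n → ℤ) (y : Fin n → Tot X), (∀ j, y j ∈ totDeg X (a j)) →
      φ (PiTensorProduct.tprod K y) = ψ (PiTensorProduct.tprod K y)) : φ = ψ := by
  refine PiTensorProduct.ext (MultilinearMap.dfinsupp_ext fun p => ?_)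
  ext x
  exact h p _ fun j => ⟨x j, rfl⟩

theorem tprod_mem {n : ℕ} {k : ℤ} (a : Fin n → ℤ) (y : Fin n → Tot X) (hk : ∑ j, a j = k)
    (hy : ∀ j, y j ∈ totDeg X (a j)) : PiTensorProduct.tprod K y ∈ tpDeg X n k :=
  Submodule.subset_span ⟨a, y, hk, hy, rfl⟩

theorem tpDeg_induction {n : ℕ} {k : ℤ} {M : Type*} [AddCommGroup M] [Module K M]
    {φ ψ : TP X n →ₗ[K] M}
    (h : ∀ (a : Fin n → ℤ) (y : Fin n → Tot X), ∑ j, a j = k → (∀ j, y j ∈ totDeg X (a j)) →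
      φ (PiTensorProduct.tprod K y) = ψ (PiTensorProduct.tprod K y))
    {t : TP X n} (ht : t ∈ tpDeg X n k) : φ t = ψ t := by
  have : tpDeg X n k ≤ LinearMap.eqLocus φ ψ := by
    refine Submodule.span_le.2 ?_
    rintro _ ⟨a, y, hk, hy, rfl⟩
    exact h a y hk hy
  exact this ht

/-- A tensor of vectors multiplied by signs. -/
theorem tprod_sign {n : ℕ} (c : Fin n → ℤˣ) (y : Fin n → Tot X) :
    PiTensorProduct.tprod K (fun j => sg K (c j) • y j) =
      sg K (∏ j, c j) • PiTensorProduct.tprod K y := by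
  rw [MultilinearMap.map_smul_univ]
  simp [sg]

theorem negOnePow_sum {n : ℕ} (a : Fin n → ℤ) :
    (∑ j, a j).negOnePow = ∏ j, (a j).negOnePow := by
  induction n with
  | zero => simp
  | succ n ih => rw [Fin.sum_univ_succ, Fin.prod_univ_succ, Int.negOnePow_add, ih]

theorem tpSign_of_mem {n : ℕ} {i : ℤ} (k : ℤ) {t : TP X n} (ht : t ∈ tpDeg X n i) :
    tpSign X n k t = sg K (i * k).negOnePow • t := by
  refine tpDeg_induction (ψ := sg K (i * k).negOnePow • LinearMap.id) ?_ ht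
  intro a y hk hy
  simp only [tpSign, PiTensorProduct.map_tprod, totSign_of_mem k (hy _), LinearMap.smul_apply,
    LinearMap.id_apply]
  rw [tprod_sign, ← hk, Finset.sum_mul, negOnePow_sum]

theorem tpJoin_tprod {m₁ m₂ m : ℕ} (h : m₁ + m₂ = m) (y : Fin m₁ → Tot X) (z : Fin m₂ → Tot X) :
    tpJoin X h (PiTensorProduct.tprod K y) (PiTensorProduct.tprod K z) =
      PiTensorProduct.tprod K fun j => Sum.elim y z ((blockEquiv h).symm j) := by
  simp [tpJoin, tpJoinEquiv]

theorem tprod_eq_tpJoin {m₁ m₂ m : ℕ} (h : m₁ + m₂ = m) (y : Fin m → Tot X) :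
    PiTensorProduct.tprod K y =
      tpJoin X h (PiTensorProduct.tprod K fun j => y (blockEquiv h (Sum.inl j)))
        (PiTensorProduct.tprod K fun j => y (blockEquiv h (Sum.inr j))) := by
  rw [tpJoin_tprod]
  congr 1
  ext1 j
  obtain ⟨j, rfl⟩ := (blockEquiv h).surjective j
  cases j <;> simp

/-- The concatenation, as a bilinear map. -/
noncomputable def tpJoinₗ (X : Ch K) {m₁ m₂ m : ℕ} (h : m₁ + m₂ = m) :
    TP X m₁ →ₗ[K] TP X m₂ →ₗ[K] TP X m :=
  (TensorProduct.mk K _ _).compr₂ (tpJoinEquiv X h).toLinearMap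

theorem tpJoinₗ_apply {m₁ m₂ m : ℕ} (h : m₁ + m₂ = m) (u : TP X m₁) (v : TP X m₂) :
    tpJoinₗ X h u v = tpJoin X h u v := rfl

/-- Linear maps on a tensor power are determined by the concatenations of homogeneous tensors. -/
theorem tpJoin_ext {m₁ m₂ m : ℕ} (h : m₁ + m₂ = m) {M : Type*} [AddCommGroup M] [Module K M]
    {φ ψ : TP X m →ₗ[K] M}
    (H : ∀ (a b : ℤ) (u : TP X m₁) (v : TP X m₂), u ∈ tpDeg X m₁ a → v ∈ tpDeg X m₂ b →
      φ (tpJoin X h u v) = ψ (tpJoin X h u v)) : φ = ψ := by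
  refine tp_ext fun a y hy => ?_
  rw [tprod_eq_tpJoin h]
  exact H _ _ _ _ (tprod_mem _ _ rfl fun j => hy _) (tprod_mem _ _ rfl fun j => hy _)

theorem tpJoin_mem {m₁ m₂ m : ℕ} (h : m₁ + m₂ = m) {a b c : ℤ} (hc : a + b = c) {u : TP X m₁}
    {v : TP X m₂} (hu : u ∈ tpDeg X m₁ a) (hv : v ∈ tpDeg X m₂ b) :
    tpJoin X h u v ∈ tpDeg X m c := by
  have h1 : tpDeg X m₁ a ≤ ⨅ v ∈ tpDeg X m₂ b, (tpDeg X m c).comap ((tpJoinₗ X h).flip v) := by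
    refine Submodule.span_le.2 ?_
    rintro _ ⟨a, y, rfl, hy, rfl⟩
    simp only [Submodule.coe_iInf, Set.mem_iInter]
    intro v hv
    have h2 : tpDeg X m₂ b ≤ (tpDeg X m c).comap (tpJoinₗ X h (PiTensorProduct.tprod K y)) := by
      refine Submodule.span_le.2 ?_
      rintro _ ⟨b, z, rfl, hz, rfl⟩
      rw [SetLike.mem_coe, Submodule.mem_comap, tpJoinₗ_apply, tpJoin_tprod]
      refine tprod_mem (fun j => Sum.elim a b ((blockEquiv h).symm j)) _ ?_ ?_
      · rw [← hc, (blockEquiv h).symm.sum_comp (fun j => Sum.elim a b j), Fintype.sum_sum_type]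
        simp
      · intro j
        obtain ⟨j, rfl⟩ := (blockEquiv h).surjective j
        cases j <;> simp [hy, hz]
    exact h2 hv
  have := h1 hu
  simp only [Submodule.mem_iInf] at this
  exact this v hv

theorem tpD_tprod {n : ℕ} (y : Fin n → Tot X) :
    tpD X n (PiTensorProduct.tprod K y) = ∑ j : Fin n, PiTensorProduct.tprod K fun i =>
      if i < j then totSign X 1 (y i) else if i = j then totD X (y i) else y i := by
  simp only [tpD, LinearMap.sum_apply, PiTensorProduct.map_tprod]
  refine Finset.sum_congr rfl fun j _ => congrArg _ (funext fun i => ?_)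
  split_ifs <;> rfl

theorem tpD_mem {n : ℕ} {k l : ℤ} (h : l + 1 = k) {t : TP X n} (ht : t ∈ tpDeg X n k) :
    tpD X n t ∈ tpDeg X n l := by
  have : tpDeg X n k ≤ (tpDeg X n l).comap (tpD X n) := by
    refine Submodule.span_le.2 ?_
    rintro _ ⟨a, y, hk, hy, rfl⟩
    simp only [Submodule.comap_coe, Set.mem_preimage, SetLike.mem_coe, tpD_tprod]
    refine Submodule.sum_mem _ fun j _ => tprod_mem (Function.update a j (a j - 1)) _ ?_ ?_
    · rw [Finset.sum_update_of_mem (Finset.mem_univ j)]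
      have := Finset.add_sum_erase Finset.univ a (Finset.mem_univ j)
      rw [Finset.sdiff_singleton_eq_erase]
      omega
    · intro i
      rcases lt_trichotomy i j with hij | rfl | hij
      · rw [if_pos hij, Function.update_of_ne hij.ne]
        exact totSign_mem 1 (hy i)
      · simp only [lt_irrefl, if_false, if_true, Function.update_self]
        exact totD_mem (by omega) (hy i)
      · rw [if_neg hij.not_gt, if_neg hij.ne', Function.update_of_ne hij.ne']
        exact hy i
  exact this ht

theorem blockEquiv_inl {m₁ m₂ m : ℕ} (h : m₁ + m₂ = m) (i : Fin m₁) :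
    blockEquiv h (Sum.inl i) = Fin.cast h (Fin.castAdd m₂ i) := rfl

theorem blockEquiv_inr {m₁ m₂ m : ℕ} (h : m₁ + m₂ = m) (i : Fin m₂) :
    blockEquiv h (Sum.inr i) = Fin.cast h (Fin.natAdd m₁ i) := rfl

theorem blockEquiv_lt {m₁ m₂ m : ℕ} (h : m₁ + m₂ = m) (i j : Fin m₁ ⊕ Fin m₂) :
    blockEquiv h i < blockEquiv h j ↔ Sum.Lex (· < ·) (· < ·) i j := by
  rcases i with i | i <;> rcases j with j | j <;>
    simp only [blockEquiv_inl, blockEquiv_inr, Fin.lt_def, Fin.val_cast, Fin.val_castAdd,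
      Fin.val_natAdd, Sum.lex_inl_inl, Sum.lex_inr_inr, Sum.Lex.sep, Sum.lex_inr_inl,
      iff_true, iff_false] <;> omega

/-- The differential is a derivation for the concatenation. -/
theorem tpD_tpJoin {m₁ m₂ m : ℕ} (h : m₁ + m₂ = m) (u : TP X m₁) (v : TP X m₂) :
    tpD X m (tpJoin X h u v) =
      tpJoin X h (tpD X m₁ u) v + tpJoin X h (tpSign X m₁ 1 u) (tpD X m₂ v) := by
  have key : (tpJoinₗ X h).compr₂ (tpD X m) =
      (tpJoinₗ X h) ∘ₗ (tpD X m₁) + ((tpJoinₗ X h) ∘ₗ (tpSign X m₁ 1)).compl₂ (tpD X m₂) := by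
    refine PiTensorProduct.ext (MultilinearMap.ext fun y => ?_)
    refine PiTensorProduct.ext (MultilinearMap.ext fun z => ?_)
    simp only [LinearMap.compMultilinearMap_apply, LinearMap.compr₂_apply, LinearMap.add_apply,
      LinearMap.comp_apply, LinearMap.compl₂_apply, tpJoinₗ_apply, tpJoin_tprod, tpD_tprod,
      tpSign, PiTensorProduct.map_tprod]
    rw [← (blockEquiv h).sum_comp, Fintype.sum_sum_type]
    simp only [← tpJoinₗ_apply, map_sum, LinearMap.sum_apply]
    simp only [tpJoinₗ_apply, tpJoin_tprod]
    congr 1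
    all_goals
      refine Finset.sum_congr rfl fun j _ => congrArg _ (funext fun i => ?_)
      obtain ⟨i, rfl⟩ := (blockEquiv h).surjective i
      rcases i with i | i <;> simp [blockEquiv_lt]
  have := LinearMap.congr_fun (LinearMap.congr_fun key u) v
  simpa [tpJoinₗ_apply] using this

theorem tpJoin_zero_left {m₁ m₂ m : ℕ} (h : m₁ + m₂ = m) (v : TP X m₂) :
    tpJoin X h 0 v = 0 := by
  rw [← tpJoinₗ_apply, map_zero, LinearMap.zero_apply]

theorem tpJoin_zero_right {m₁ m₂ m : ℕ} (h : m₁ + m₂ = m) (u : TP X m₁) :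
    tpJoin X h u 0 = 0 := by
  rw [← tpJoinₗ_apply, map_zero]

theorem tpJoin_smul_left {m₁ m₂ m : ℕ} (h : m₁ + m₂ = m) (c : K) (u : TP X m₁) (v : TP X m₂) :
    tpJoin X h (c • u) v = c • tpJoin X h u v := by
  rw [← tpJoinₗ_apply, map_smul, LinearMap.smul_apply, tpJoinₗ_apply]

theorem tpJoin_smul_right {m₁ m₂ m : ℕ} (h : m₁ + m₂ = m) (c : K) (u : TP X m₁) (v : TP X m₂) :
    tpJoin X h u (c • v) = c • tpJoin X h u v := by
  rw [← tpJoinₗ_apply, map_smul, tpJoinₗ_apply]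

theorem tpD_zero (t : TP X 0) : tpD X 0 t = 0 := by simp [tpD]

theorem tpD_one_tpD_one (t : TP X 1) : tpD X 1 (tpD X 1 t) = 0 := by
  have : tpD X 1 ∘ₗ tpD X 1 = 0 := by
    refine PiTensorProduct.ext (MultilinearMap.ext fun y => ?_)
    simp only [LinearMap.compMultilinearMap_apply, LinearMap.comp_apply, tpD_tprod,
      Finset.univ_unique, Finset.sum_singleton, LinearMap.zero_apply]
    exact MultilinearMap.map_coord_zero _ 0 (by simp [totD_totD])
  exact LinearMap.congr_fun this t

theorem tpJoin_tpD_of_mem {m₁ m₂ m : ℕ} (h : m₁ + m₂ = m) {a : ℤ} {u : TP X m₁}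
    (hu : u ∈ tpDeg X m₁ a) (v : TP X m₂) :
    tpD X m (tpJoin X h u v) =
      tpJoin X h (tpD X m₁ u) v + sg K a.negOnePow • tpJoin X h u (tpD X m₂ v) := by
  rw [tpD_tpJoin, tpSign_of_mem 1 hu, tpJoin_smul_left, mul_one]

theorem tpD_tpD {n : ℕ} (t : TP X n) : tpD X n (tpD X n t) = 0 := by
  induction n with
  | zero => rw [tpD_zero]
  | succ n ih =>
    have : tpD X (n + 1) ∘ₗ tpD X (n + 1) = 0 := by
      refine tpJoin_ext (rfl : n + 1 = n + 1) fun a b u v hu hv => ?_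
      rw [LinearMap.comp_apply, tpJoin_tpD_of_mem _ hu, map_add, map_smul,
        tpJoin_tpD_of_mem _ hu, tpJoin_tpD_of_mem _ (tpD_mem (sub_add_cancel a 1) hu), ih,
        tpD_one_tpD_one, tpJoin_zero_left, tpJoin_zero_right,
        Int.negOnePow_sub, Int.negOnePow_one, mul_neg, mul_one, sg_neg,
        smul_zero, add_zero, zero_add, ← add_smul, neg_add_cancel, zero_smul, LinearMap.zero_apply]
    exact LinearMap.congr_fun this t

section Koszul

/-- A product over the pairs `i < j` of a symmetric function is invariant under permutations. -/
theorem prod_pairs_comp {n : ℕ} (σ : Equiv.Perm (Fin n)) (g : Fin n → Fin n → ℤˣ)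
    (hg : ∀ i j, g i j = g j i) :
    (∏ i, ∏ j, if i < j then g (σ i) (σ j) else 1) = ∏ i, ∏ j, if i < j then g i j else 1 := by
  have e (f : Fin n → Fin n → ℤˣ) : (∏ i, ∏ j, if i < j then f i j else 1) =
      ∏ p : Fin n × Fin n with p.1 < p.2, f p.1 p.2 := by
    rw [Finset.prod_filter, Fintype.prod_prod_type]
  rw [e, e]
  refine Finset.prod_bij' (fun p _ => if σ p.1 < σ p.2 then (σ p.1, σ p.2) else (σ p.2, σ p.1))
    (fun p _ => if σ.symm p.1 < σ.symm p.2 then (σ.symm p.1, σ.symm p.2)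
      else (σ.symm p.2, σ.symm p.1)) ?_ ?_ ?_ ?_ ?_
  · rintro ⟨i, j⟩ h
    simp only [Finset.mem_filter, Finset.mem_univ, true_and] at h ⊢
    split_ifs with h'
    · exact h'
    · exact lt_of_le_of_ne (not_lt.1 h') fun h'' => h.ne' (σ.injective h'')
  · rintro ⟨i, j⟩ h
    simp only [Finset.mem_filter, Finset.mem_univ, true_and] at h ⊢
    split_ifs with h'
    · exact h'
    · exact lt_of_le_of_ne (not_lt.1 h') fun h'' => h.ne' (σ.symm.injective h'')
  · rintro ⟨i, j⟩ h
    simp only [Finset.mem_filter, Finset.mem_univ, true_and] at h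
    by_cases h' : σ i < σ j <;> simp [h', h, h.not_gt]
  · rintro ⟨i, j⟩ h
    simp only [Finset.mem_filter, Finset.mem_univ, true_and] at h
    by_cases h' : σ.symm i < σ.symm j <;> simp [h', h, h.not_gt]
  · rintro ⟨i, j⟩ h
    dsimp only
    split_ifs
    · rfl
    · exact hg _ _

theorem koszul_eq {n : ℕ} (σ : Equiv.Perm (Fin n)) (a : Fin n → ℤ) :
    koszul σ a = ∏ i, ∏ j, if i < j then
      (if (i < j ↔ σ i < σ j) then 1 else (a i * a j).negOnePow) else 1 := by
  refine Finset.prod_congr rfl fun i _ => Finset.prod_congr rfl fun j _ => ?_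
  by_cases h : i < j
  · have : σ i ≠ σ j := fun h' => h.ne (σ.injective h')
    rcases this.lt_or_gt with h' | h' <;> simp [h, h', h'.not_gt]
  · simp [h]

theorem koszul_one {n : ℕ} (a : Fin n → ℤ) : koszul 1 a = 1 := by
  simp [koszul_eq]

theorem koszul_mul {n : ℕ} (σ τ : Equiv.Perm (Fin n)) (a : Fin n → ℤ) :
    koszul (σ * τ) a = koszul σ (fun j => a (τ.symm j)) * koszul τ a := by
  rw [koszul_eq σ, ← prod_pairs_comp τ, koszul_eq τ, koszul_eq, ← Finset.prod_mul_distrib]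
  · refine Finset.prod_congr rfl fun i _ => ?_
    rw [← Finset.prod_mul_distrib]
    refine Finset.prod_congr rfl fun j _ => ?_
    by_cases h : i < j
    · by_cases h1 : τ i < τ j <;> by_cases h2 : σ (τ i) < σ (τ j) <;>
        simp [h, h1, h2]
    · simp [h]
  · intro i j
    by_cases hij : i = j
    · rw [hij]
    · have h1 : σ i ≠ σ j := fun h => hij (σ.injective h)
      have h2 : (i < j ↔ σ i < σ j) ↔ (j < i ↔ σ j < σ i) := by
        rcases lt_or_gt_of_ne hij with h | h <;> rcases lt_or_gt_of_ne h1 with h' | h' <;>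
          simp [h, h', h.not_gt, h'.not_gt]
      simp only [h2, mul_comm (a (τ.symm i))]

theorem koszul_congr {n : ℕ} (σ : Equiv.Perm (Fin n)) {a b : Fin n → ℤ}
    (h : ∀ j, Even (a j - b j)) : koszul σ a = koszul σ b := by
  refine Finset.prod_congr rfl fun i _ => Finset.prod_congr rfl fun j _ => ?_
  have : (a i * a j).negOnePow = (b i * b j).negOnePow := by
    rw [Int.negOnePow_eq_iff]
    have : a i * a j - b i * b j = (a i - b i) * a j + b i * (a j - b j) := by ring
    rw [this]
    exact ((h i).mul_right _).add ((h j).mul_left _)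
  rw [this]

/-- How the Koszul sign changes when the degree of one factor drops by one. -/
theorem koszul_update {n : ℕ} (σ : Equiv.Perm (Fin n)) (a : Fin n → ℤ) (j : Fin n) :
    (∏ i, if i < j then (a i).negOnePow else 1) * koszul σ (Function.update a j (a j - 1)) =
      koszul σ a * ∏ i, if σ i < σ j then (a i).negOnePow else 1 := by
  have key : koszul σ (Function.update a j (a j - 1)) =
      koszul σ a * ((∏ i, if i < j ∧ σ j < σ i then (a i).negOnePow else 1) *
        ∏ i, if j < i ∧ σ i < σ j then (a i).negOnePow else 1) := by
    have e1 : (∏ i, if i < j ∧ σ j < σ i then (a i).negOnePow else 1) =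
        ∏ i, ∏ k, if k = j then (if i < j ∧ σ j < σ i then (a i).negOnePow else 1) else 1 := by
      simp
    have e2 : (∏ i, if j < i ∧ σ i < σ j then (a i).negOnePow else 1) =
        ∏ i, ∏ k, if i = j then (if j < k ∧ σ k < σ j then (a k).negOnePow else 1) else 1 := by
      rw [Finset.prod_comm]
      simp
    rw [e1, e2]
    simp only [koszul, ← Finset.prod_mul_distrib]
    refine Finset.prod_congr rfl fun i _ => Finset.prod_congr rfl fun k _ => ?_
    by_cases hi : i = j
    · subst hi
      by_cases hk : k = i
      · subst hk
        simp
      · by_cases h : i < k ∧ σ k < σ i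
        · simp [hk, h, sub_mul, Int.negOnePow_sub]
        · simp [hk, h]
    · by_cases hk : k = j
      · subst hk
        by_cases h : i < k ∧ σ k < σ i
        · simp [hi, h, mul_sub, Int.negOnePow_sub]
        · simp [hi, h]
      · simp [hi, hk]
  rw [key, mul_left_comm, ← Finset.prod_mul_distrib, ← Finset.prod_mul_distrib]
  congr 1
  refine Finset.prod_congr rfl fun i _ => ?_
  by_cases hi : i = j
  · subst hi
    simp
  · have h1 : σ i ≠ σ j := fun h => hi (σ.injective h)
    rcases lt_or_gt_of_ne hi with h | h <;> rcases lt_or_gt_of_ne h1 with h' | h' <;>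
      simp [h, h', h.not_gt, h'.not_gt]

theorem koszul_blockSum {m₁ m₂ m : ℕ} (h : m₁ + m₂ = m) (σ : Equiv.Perm (Fin m₁))
    (τ : Equiv.Perm (Fin m₂)) (a : Fin m → ℤ) :
    koszul (blockSum h σ τ) a = koszul σ (fun j => a (blockEquiv h (Sum.inl j))) *
      koszul τ (fun j => a (blockEquiv h (Sum.inr j))) := by
  simp only [koszul]
  rw [← (blockEquiv h).prod_comp, Fintype.prod_sum_type]
  congr 1 <;> refine Finset.prod_congr rfl fun i _ => ?_ <;>
    rw [← (blockEquiv h).prod_comp, Fintype.prod_sum_type] <;>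
    simp [blockSum, blockEquiv_lt]

theorem koszul_blockSwap {m₁ m₂ m : ℕ} (h : m₁ + m₂ = m) (a : Fin m → ℤ) :
    koszul (blockSwap h) a = ((∑ j, a (blockEquiv h (Sum.inl j))) *
      ∑ j, a (blockEquiv h (Sum.inr j))).negOnePow := by
  simp only [koszul]
  have e : ∀ i j, (blockSwap h (blockEquiv h j) < blockSwap h (blockEquiv h i)) ↔
      Sum.Lex (· < ·) (· < ·) j.swap i.swap := by
    intro i j
    simp [blockSwap, blockEquiv_lt]
  rw [← (blockEquiv h).prod_comp, Fintype.prod_sum_type, Finset.sum_mul_sum, negOnePow_sum]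
  simp only [negOnePow_sum]
  rw [← mul_one (∏ i, ∏ j, Int.negOnePow _)]
  congr 1
  · refine Finset.prod_congr rfl fun i _ => ?_
    rw [← (blockEquiv h).prod_comp, Fintype.prod_sum_type]
    simp only [e, blockEquiv_lt]
    have (j : Fin m₁) : ¬ (i < j ∧ j < i) := fun hj => lt_asymm hj.1 hj.2
    simp [this]
  · refine Finset.prod_eq_one fun i _ => ?_
    rw [← (blockEquiv h).prod_comp, Fintype.prod_sum_type]
    simp only [e, blockEquiv_lt]
    have (j : Fin m₂) : ¬ (i < j ∧ j < i) := fun hj => lt_asymm hj.1 hj.2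
    simp [this]

end Koszul

section Perm

theorem tpPerm_tprod {n : ℕ} (σ : Equiv.Perm (Fin n)) {a : Fin n → ℤ} {y : Fin n → Tot X}
    (hy : ∀ j, y j ∈ totDeg X (a j)) :
    tpPerm X σ (PiTensorProduct.tprod K y) =
      sg K (koszul σ a) • PiTensorProduct.tprod K fun j => y (σ.symm j) := by
  have hm (j : Fin n) : 0 ≤ a j % 2 ∧ a j % 2 < 2 := by omega
  let e : Fin n → Fin 2 := fun j => ⟨(a j % 2).toNat, by have := hm j; omega⟩
  have he (j : Fin n) : a j % 2 = ((e j).val : ℤ) := by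
    have := hm j
    simp only [e]
    omega
  simp only [tpPerm, LinearMap.sum_apply, LinearMap.smul_apply, LinearMap.comp_apply,
    PiTensorProduct.map_tprod, LinearEquiv.coe_coe, PiTensorProduct.reindex_tprod,
    totParity_of_mem _ (hy _)]
  rw [Finset.sum_eq_single e]
  · congr 1
    · refine congrArg _ (koszul_congr σ fun j => ?_)
      rw [← he, Int.even_iff]
      omega
    · simp [he]
  · intro e' _ hne
    obtain ⟨j, hj⟩ := Function.ne_iff.1 hne
    rw [MultilinearMap.map_coord_zero _ (σ j), smul_zero]
    rw [if_neg]
    simp only [Equiv.symm_apply_apply]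
    intro h
    apply hj
    rw [he] at h
    exact (Fin.ext (by exact_mod_cast h)).symm
  · simp

theorem tpPerm_mem {n : ℕ} (σ : Equiv.Perm (Fin n)) {k : ℤ} {t : TP X n} (ht : t ∈ tpDeg X n k) :
    tpPerm X σ t ∈ tpDeg X n k := by
  have : tpDeg X n k ≤ (tpDeg X n k).comap (tpPerm X σ) := by
    refine Submodule.span_le.2 ?_
    rintro _ ⟨a, y, hk, hy, rfl⟩
    rw [SetLike.mem_coe, Submodule.mem_comap, tpPerm_tprod σ hy]
    refine Submodule.smul_mem _ _ (tprod_mem (fun j => a (σ.symm j)) _ ?_ fun j => hy _)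
    rw [σ.symm.sum_comp, hk]
  exact this ht

theorem tpPerm_one {n : ℕ} (t : TP X n) : tpPerm X 1 t = t := by
  have : tpPerm X (1 : Equiv.Perm (Fin n)) = LinearMap.id := by
    refine tp_ext fun a y hy => ?_
    rw [tpPerm_tprod _ hy, koszul_one, sg_one, one_smul]
    rfl
  rw [this, LinearMap.id_apply]

theorem tpPerm_mul {n : ℕ} (σ τ : Equiv.Perm (Fin n)) (t : TP X n) :
    tpPerm X (σ * τ) t = tpPerm X σ (tpPerm X τ t) := by
  have : tpPerm X (σ * τ) = tpPerm X σ ∘ₗ tpPerm X τ := by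
    refine tp_ext fun a y hy => ?_
    rw [LinearMap.comp_apply, tpPerm_tprod _ hy, tpPerm_tprod _ hy, map_smul,
      tpPerm_tprod σ (a := fun j => a (τ.symm j)) (fun j => hy _), sg_smul_sg, koszul_mul,
      mul_comm]
    rfl
  rw [this, LinearMap.comp_apply]

theorem tpD_tprod_of_mem {n : ℕ} {a : Fin n → ℤ} {y : Fin n → Tot X}
    (hy : ∀ j, y j ∈ totDeg X (a j)) :
    tpD X n (PiTensorProduct.tprod K y) =
      ∑ j, sg K (∏ i, if i < j then (a i).negOnePow else 1) •
        PiTensorProduct.tprod K (Function.update y j (totD X (y j))) := by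
  rw [tpD_tprod]
  refine Finset.sum_congr rfl fun j _ => ?_
  rw [← tprod_sign]
  refine congrArg _ (funext fun i => ?_)
  rcases lt_trichotomy i j with h | rfl | h
  · simp [h, h.ne, totSign_of_mem 1 (hy i)]
  · simp [sg_one]
  · simp [h.not_gt, h.ne', sg_one]

theorem update_mem {n : ℕ} {a : Fin n → ℤ} {y : Fin n → Tot X}
    (hy : ∀ j, y j ∈ totDeg X (a j)) (j i : Fin n) :
    Function.update y j (totD X (y j)) i ∈ totDeg X (Function.update a j (a j - 1) i) := by
  by_cases h : i = j
  · subst h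
    simpa using totD_mem (by omega) (hy i)
  · simpa [h] using hy i

/-- Permutations act by chain maps. -/
theorem tpD_tpPerm {n : ℕ} (σ : Equiv.Perm (Fin n)) (t : TP X n) :
    tpD X n (tpPerm X σ t) = tpPerm X σ (tpD X n t) := by
  have : tpD X n ∘ₗ tpPerm X σ = tpPerm X σ ∘ₗ tpD X n := by
    refine tp_ext fun a y hy => ?_
    rw [LinearMap.comp_apply, LinearMap.comp_apply, tpPerm_tprod σ hy, map_smul,
      tpD_tprod_of_mem hy, tpD_tprod_of_mem (a := fun j => a (σ.symm j)) (fun j => hy _), map_sum,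
      Finset.smul_sum, ← Equiv.sum_comp σ]
    refine Finset.sum_congr rfl fun j _ => ?_
    rw [map_smul, tpPerm_tprod σ (update_mem hy j), sg_smul_sg, sg_smul_sg, koszul_update,
      ← Equiv.prod_comp σ]
    simp only [Equiv.symm_apply_apply]
    congr 2
    ext1 i
    obtain ⟨i, rfl⟩ := σ.surjective i
    by_cases h : i = j
    · subst h
      simp
    · simp [h]
  exact LinearMap.congr_fun this t

theorem blockSum_symm_apply {m₁ m₂ m : ℕ} (h : m₁ + m₂ = m) (σ : Equiv.Perm (Fin m₁))
    (τ : Equiv.Perm (Fin m₂)) (j : Fin m₁ ⊕ Fin m₂) :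
    (blockSum h σ τ).symm (blockEquiv h j) =
      blockEquiv h (Equiv.sumCongr σ.symm τ.symm j) := by
  rw [Equiv.symm_apply_eq]
  cases j <;> simp [blockSum]

theorem tpPerm_blockSum {m₁ m₂ m : ℕ} (h : m₁ + m₂ = m) (σ : Equiv.Perm (Fin m₁))
    (τ : Equiv.Perm (Fin m₂)) (u : TP X m₁) (v : TP X m₂) :
    tpPerm X (blockSum h σ τ) (tpJoin X h u v) = tpJoin X h (tpPerm X σ u) (tpPerm X τ v) := by
  have : (tpJoinₗ X h).compr₂ (tpPerm X (blockSum h σ τ)) =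
      ((tpJoinₗ X h) ∘ₗ tpPerm X σ).compl₂ (tpPerm X τ) := by
    refine tp_ext fun a y hy => tp_ext fun b z hz => ?_
    simp only [LinearMap.compr₂_apply, LinearMap.comp_apply, LinearMap.compl₂_apply]
    rw [tpPerm_tprod σ hy, tpPerm_tprod τ hz, map_smul, map_smul, LinearMap.smul_apply,
      tpJoinₗ_apply, tpJoinₗ_apply, tpJoin_tprod, tpJoin_tprod, sg_smul_sg,
      tpPerm_tprod _ (a := fun j => Sum.elim a b ((blockEquiv h).symm j)), koszul_blockSum]
    · simp only [Equiv.symm_apply_apply, Sum.elim_inl, Sum.elim_inr, mul_comm]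
      congr 2
      ext1 j
      obtain ⟨j, rfl⟩ := (blockEquiv h).surjective j
      cases j <;> simp [blockSum_symm_apply]
    · intro j
      obtain ⟨j, rfl⟩ := (blockEquiv h).surjective j
      cases j <;> simp [hy, hz]
  exact LinearMap.congr_fun (LinearMap.congr_fun this u) v

theorem tpDeg_induction₂ {m₁ m₂ : ℕ} {p q : ℤ} {M : Type*} [AddCommGroup M] [Module K M]
    {φ ψ : TP X m₁ →ₗ[K] TP X m₂ →ₗ[K] M}
    (h : ∀ (a : Fin m₁ → ℤ) (y : Fin m₁ → Tot X) (b : Fin m₂ → ℤ) (z : Fin m₂ → Tot X),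
      ∑ j, a j = p → (∀ j, y j ∈ totDeg X (a j)) → ∑ j, b j = q → (∀ j, z j ∈ totDeg X (b j)) →
      φ (PiTensorProduct.tprod K y) (PiTensorProduct.tprod K z) =
        ψ (PiTensorProduct.tprod K y) (PiTensorProduct.tprod K z))
    {u : TP X m₁} {v : TP X m₂} (hu : u ∈ tpDeg X m₁ p) (hv : v ∈ tpDeg X m₂ q) :
    φ u v = ψ u v := by
  refine tpDeg_induction (φ := φ.flip v) (ψ := ψ.flip v) (fun a y ha hy => ?_) hu
  exact tpDeg_induction (fun b z hb hz => h a y b z ha hy hb hz) hv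

theorem tpPerm_blockSwap {m₁ m₂ m : ℕ} (h : m₁ + m₂ = m) (h' : m₂ + m₁ = m) {p q : ℤ}
    {u : TP X m₁} {v : TP X m₂} (hu : u ∈ tpDeg X m₁ p) (hv : v ∈ tpDeg X m₂ q) :
    tpPerm X (blockSwap h) (tpJoin X h u v) = sg K (p * q).negOnePow • tpJoin X h' v u := by
  refine tpDeg_induction₂ (φ := (tpJoinₗ X h).compr₂ (tpPerm X (blockSwap h)))
    (ψ := sg K (p * q).negOnePow • (tpJoinₗ X h').flip) ?_ hu hv
  intro a y b z ha hy hb hz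
  simp only [LinearMap.compr₂_apply, LinearMap.smul_apply, LinearMap.flip_apply, tpJoinₗ_apply,
    tpJoin_tprod]
  rw [tpPerm_tprod _ (a := fun j => Sum.elim a b ((blockEquiv h).symm j)), koszul_blockSwap]
  · simp only [Equiv.symm_apply_apply, Sum.elim_inl, Sum.elim_inr, ha, hb]
    congr 2
    ext1 j
    obtain ⟨j, rfl⟩ := (blockEquiv h').surjective j
    cases j <;> simp [blockSwap]
  · intro j
    obtain ⟨j, rfl⟩ := (blockEquiv h).surjective j
    cases j <;> simp [hy, hz]

end Perm

section Assoc

theorem tpJoin_assoc {m₁ m₂ m₃ m₁₂ m₂₃ m : ℕ} (h₁₂ : m₁ + m₂ = m₁₂) (h₂₃ : m₂ + m₃ = m₂₃)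
    (h : m₁₂ + m₃ = m) (h' : m₁ + m₂₃ = m) (u : TP X m₁) (v : TP X m₂) (w : TP X m₃) :
    tpJoin X h (tpJoin X h₁₂ u v) w = tpJoin X h' u (tpJoin X h₂₃ v w) := by
  have H1 (y : Fin m₁ → Tot X) (z : Fin m₂ → Tot X) :
      tpJoinₗ X h (tpJoin X h₁₂ (PiTensorProduct.tprod K y) (PiTensorProduct.tprod K z)) =
        tpJoinₗ X h' (PiTensorProduct.tprod K y) ∘ₗ
          tpJoinₗ X h₂₃ (PiTensorProduct.tprod K z) := by
    refine PiTensorProduct.ext (MultilinearMap.ext fun x => ?_)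
    simp only [LinearMap.compMultilinearMap_apply, LinearMap.comp_apply, tpJoinₗ_apply,
      tpJoin_tprod]
    refine congrArg _ (funext fun j => ?_)
    obtain ⟨j, rfl⟩ := (blockEquiv h).surjective j
    rcases j with j | j
    · obtain ⟨j, rfl⟩ := (blockEquiv h₁₂).surjective j
      rcases j with j | j
      · have : blockEquiv h (Sum.inl (blockEquiv h₁₂ (Sum.inl j))) =
            blockEquiv h' (Sum.inl j) := by
          simp [blockEquiv_inl, Fin.ext_iff]
        rw [Equiv.symm_apply_apply, this]
        simp
      · have : blockEquiv h (Sum.inl (blockEquiv h₁₂ (Sum.inr j))) =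
            blockEquiv h' (Sum.inr (blockEquiv h₂₃ (Sum.inl j))) := by
          simp [blockEquiv_inl, blockEquiv_inr, Fin.ext_iff]
        rw [Equiv.symm_apply_apply, this]
        simp
    · have : blockEquiv h (Sum.inr j) = blockEquiv h' (Sum.inr (blockEquiv h₂₃ (Sum.inr j))) := by
        simp only [blockEquiv_inr, Fin.ext_iff, Fin.val_cast, Fin.val_natAdd]
        omega
      rw [Equiv.symm_apply_apply, this]
      simp
  have H2 (y : Fin m₁ → Tot X) (w : TP X m₃) :
      (tpJoinₗ X h).flip w ∘ₗ tpJoinₗ X h₁₂ (PiTensorProduct.tprod K y) =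
        tpJoinₗ X h' (PiTensorProduct.tprod K y) ∘ₗ (tpJoinₗ X h₂₃).flip w :=
    PiTensorProduct.ext (MultilinearMap.ext fun z => LinearMap.congr_fun (H1 y z) w)
  have H3 : (tpJoinₗ X h).flip w ∘ₗ (tpJoinₗ X h₁₂).flip v =
      (tpJoinₗ X h').flip (tpJoin X h₂₃ v w) :=
    PiTensorProduct.ext (MultilinearMap.ext fun y => LinearMap.congr_fun (H2 y w) v)
  exact LinearMap.congr_fun H3 u

theorem tpJoin_unit_left {m : ℕ} (h : 0 + m = m) (y : Fin 0 → Tot X) (v : TP X m) :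
    tpJoin X h (PiTensorProduct.tprod K y) v = v := by
  have : tpJoinₗ X h (PiTensorProduct.tprod K y) = LinearMap.id := by
    refine PiTensorProduct.ext (MultilinearMap.ext fun z => ?_)
    simp only [LinearMap.compMultilinearMap_apply, tpJoinₗ_apply, tpJoin_tprod,
      LinearMap.id_apply]
    refine congrArg _ (funext fun j => ?_)
    obtain ⟨j, rfl⟩ := (blockEquiv h).surjective j
    rcases j with j | j
    · exact j.elim0
    · have : blockEquiv h (Sum.inr j) = j := by simp [blockEquiv_inr]
      rw [Equiv.symm_apply_apply, this]
      rfl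
  exact LinearMap.congr_fun this v

theorem tpJoin_unit_right {m : ℕ} (h : m + 0 = m) (y : Fin 0 → Tot X) (v : TP X m) :
    tpJoin X h v (PiTensorProduct.tprod K y) = v := by
  have : (tpJoinₗ X h).flip (PiTensorProduct.tprod K y) = LinearMap.id := by
    refine PiTensorProduct.ext (MultilinearMap.ext fun z => ?_)
    simp only [LinearMap.compMultilinearMap_apply, LinearMap.flip_apply, tpJoinₗ_apply,
      tpJoin_tprod, LinearMap.id_apply]
    refine congrArg _ (funext fun j => ?_)
    obtain ⟨j, rfl⟩ := (blockEquiv h).surjective j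
    rcases j with j | j
    · rw [Equiv.symm_apply_apply]
      rfl
    · exact j.elim0
  exact LinearMap.congr_fun this v

end Assoc
end Lemmas

section Hom

/-- The homogeneous maps `X^{⊗ m} → X^{⊗ n}` of degree `k`. -/
def homDeg (X : Ch K) (m n : ℕ) (k : ℤ) : Submodule K (TP X m →ₗ[K] TP X n) where
  carrier := {f | ∀ (a b : ℤ), a + k = b → ∀ t ∈ tpDeg X m a, f t ∈ tpDeg X n b}
  add_mem' hf hg a b h t ht := Submodule.add_mem _ (hf a b h t ht) (hg a b h t ht)
  zero_mem' _ _ _ _ _ := Submodule.zero_mem _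
  smul_mem' c _ hf a b h t ht := Submodule.smul_mem _ c (hf a b h t ht)

variable {X : Ch K}

theorem homDeg_comp_mem {m k n : ℕ} {i j l : ℤ} (h : i + j = l) {f : TP X k →ₗ[K] TP X n}
    {g : TP X m →ₗ[K] TP X k} (hf : f ∈ homDeg X k n i) (hg : g ∈ homDeg X m k j) :
    f ∘ₗ g ∈ homDeg X m n l :=
  fun a b hab t ht => hf (a + j) b (by omega) _ (hg a (a + j) rfl t ht)

theorem homDeg_D_mem {m n : ℕ} {k l : ℤ} (h : l + 1 = k) {f : TP X m →ₗ[K] TP X n}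
    (hf : f ∈ homDeg X m n k) :
    tpD X n ∘ₗ f - sg K k.negOnePow • (f ∘ₗ tpD X m) ∈ homDeg X m n l :=
  fun a b hab t ht => Submodule.sub_mem _ (tpD_mem (by omega) (hf a (b + 1) (by omega) t ht))
    (Submodule.smul_mem _ _ (hf (a - 1) b (by omega) _ (tpD_mem (by omega) ht)))

/-- The differential `f ↦ d ∘ f - (-1) ^ |f| f ∘ d` on homogeneous maps `X^{⊗ m} → X^{⊗ n}`. -/
noncomputable def homD (X : Ch K) (m n : ℕ) {k l : ℤ} (h : l + 1 = k) :
    homDeg X m n k →ₗ[K] homDeg X m n l where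
  toFun f := ⟨tpD X n ∘ₗ f.1 - sg K k.negOnePow • (f.1 ∘ₗ tpD X m), homDeg_D_mem h f.2⟩
  map_add' f g := by
    ext1
    simp only [Submodule.coe_add, LinearMap.comp_add, LinearMap.add_comp, smul_add]
    abel
  map_smul' c f := by
    ext1
    simp only [Submodule.coe_smul, LinearMap.comp_smul, LinearMap.smul_comp, smul_sub,
      RingHom.id_apply, smul_comm c]

/-- The complex `Hom(X^{⊗ m}, X^{⊗ n})` (the internal hom of chain complexes). -/
noncomputable def homComplex (X : Ch K) (m n : ℕ) : Ch K where
  X k := ModuleCat.of K (homDeg X m n k)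
  d k l := if h : l + 1 = k then ModuleCat.ofHom (homD X m n h) else 0
  shape k l h := dif_neg h
  d_comp_d' i j k hij hjk := by
    change j + 1 = i at hij
    change k + 1 = j at hjk
    rw [dif_pos hij, dif_pos hjk]
    ext f : 2
    refine Subtype.ext (LinearMap.ext fun t => ?_)
    subst hij
    change tpD X n (tpD X n (f.1 t) - sg K (j + 1).negOnePow • f.1 (tpD X m t)) -
      sg K j.negOnePow • (tpD X n (f.1 (tpD X m t)) -
        sg K (j + 1).negOnePow • f.1 (tpD X m (tpD X m t))) = 0
    rw [map_sub, tpD_tpD, tpD_tpD, map_zero, smul_zero, sub_zero, zero_sub, map_smul,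
      Int.negOnePow_succ, sg_neg, neg_smul, neg_neg, sub_self]

/-- The tensor product `f ⊗ g` of maps between tensor powers, where `g` has degree `j`:
`(f ⊗ g) (u ⊗ v) = (-1) ^ (j * |u|) f u ⊗ g v`. -/
noncomputable def homTensor (X : Ch K) {m₁ m₂ m n₁ n₂ n : ℕ} (hm : m₁ + m₂ = m)
    (hn : n₁ + n₂ = n) (j : ℤ) (f : TP X m₁ →ₗ[K] TP X n₁) (g : TP X m₂ →ₗ[K] TP X n₂) :
    TP X m →ₗ[K] TP X n :=
  (tpJoinEquiv X hn).toLinearMap ∘ₗ TensorProduct.map (f ∘ₗ tpSign X m₁ j) g ∘ₗ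
    (tpJoinEquiv X hm).symm.toLinearMap

theorem homTensor_tpJoin {m₁ m₂ m n₁ n₂ n : ℕ} (hm : m₁ + m₂ = m) (hn : n₁ + n₂ = n) {a j : ℤ}
    (f : TP X m₁ →ₗ[K] TP X n₁) (g : TP X m₂ →ₗ[K] TP X n₂) {u : TP X m₁}
    (hu : u ∈ tpDeg X m₁ a) (v : TP X m₂) :
    homTensor X hm hn j f g (tpJoin X hm u v) =
      sg K (a * j).negOnePow • tpJoin X hn (f u) (g v) := by
  simp only [homTensor, LinearMap.comp_apply, LinearEquiv.coe_coe, tpJoin,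
    LinearEquiv.symm_apply_apply, TensorProduct.map_tmul, tpSign_of_mem j hu, map_smul]
  rw [← TensorProduct.smul_tmul', map_smul]

theorem tpDeg_le_of_tpJoin {m₁ m₂ m : ℕ} (h : m₁ + m₂ = m) {k : ℤ} (S : Submodule K (TP X m))
    (H : ∀ (a b : ℤ) (u : TP X m₁) (v : TP X m₂), a + b = k → u ∈ tpDeg X m₁ a →
      v ∈ tpDeg X m₂ b → tpJoin X h u v ∈ S) : tpDeg X m k ≤ S := by
  refine Submodule.span_le.2 ?_
  rintro _ ⟨a, y, hk, hy, rfl⟩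
  rw [tprod_eq_tpJoin h]
  refine H _ _ _ _ ?_ (tprod_mem _ _ rfl fun j => hy _) (tprod_mem _ _ rfl fun j => hy _)
  rw [← hk, ← (blockEquiv h).sum_comp, Fintype.sum_sum_type]

theorem homTensor_mem {m₁ m₂ m n₁ n₂ n : ℕ} (hm : m₁ + m₂ = m) (hn : n₁ + n₂ = n) {i j l : ℤ}
    (h : i + j = l) {f : TP X m₁ →ₗ[K] TP X n₁} {g : TP X m₂ →ₗ[K] TP X n₂}
    (hf : f ∈ homDeg X m₁ n₁ i) (hg : g ∈ homDeg X m₂ n₂ j) :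
    homTensor X hm hn j f g ∈ homDeg X m n l := by
  intro a b hab
  refine tpDeg_le_of_tpJoin hm ((tpDeg X n b).comap (homTensor X hm hn j f g)) ?_
  intro p q u v hpq hu hv
  rw [Submodule.mem_comap, homTensor_tpJoin hm hn f g hu]
  exact Submodule.smul_mem _ _
    (tpJoin_mem hn (by omega) (hf p _ rfl u hu) (hg q _ rfl v hv))

/-- The composition of homogeneous maps. -/
noncomputable def homVcomp (X : Ch K) {m k n : ℕ} {i j l : ℤ} (h : i + j = l) :
    homDeg X k n i →ₗ[K] homDeg X m k j →ₗ[K] homDeg X m n l :=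
  LinearMap.mk₂ K (fun f g => ⟨f.1 ∘ₗ g.1, homDeg_comp_mem h f.2 g.2⟩)
    (fun _ _ _ => rfl) (fun _ _ _ => rfl)
    (fun f g g' => Subtype.ext (LinearMap.comp_add g.1 g'.1 f.1))
    (fun _ _ _ => Subtype.ext (LinearMap.comp_smul _ _ _))

/-- The tensor product of homogeneous maps. -/
noncomputable def homHcomp (X : Ch K) {m₁ m₂ m n₁ n₂ n : ℕ} (hm : m₁ + m₂ = m)
    (hn : n₁ + n₂ = n) {i j l : ℤ} (h : i + j = l) :
    homDeg X m₁ n₁ i →ₗ[K] homDeg X m₂ n₂ j →ₗ[K] homDeg X m n l :=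
  LinearMap.mk₂ K (fun f g => ⟨homTensor X hm hn j f.1 g.1, homTensor_mem hm hn h f.2 g.2⟩)
    (fun f f' g => Subtype.ext (by
      simp [homTensor, LinearMap.add_comp, LinearMap.comp_add, TensorProduct.map_add_left]))
    (fun c f g => Subtype.ext (by
      simp [homTensor, LinearMap.smul_comp, LinearMap.comp_smul, TensorProduct.map_smul_left]))
    (fun f g g' => Subtype.ext (by
      simp [homTensor, LinearMap.add_comp, LinearMap.comp_add, TensorProduct.map_add_right]))
    (fun c f g => Subtype.ext (by
      simp [homTensor, LinearMap.smul_comp, LinearMap.comp_smul, TensorProduct.map_smul_right]))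

/-- The action of a permutation, as a homogeneous map of degree `0`. -/
noncomputable def homPerm (X : Ch K) {n : ℕ} (σ : Equiv.Perm (Fin n)) : homDeg X n n 0 :=
  ⟨tpPerm X σ, fun a b hab t ht => by
    obtain rfl : a = b := by omega
    exact tpPerm_mem σ ht⟩

end Hom

end Chain

/-- A dg prop over `K`: a family of chain complexes `op m n` (operations with `m` inputs and `n`
outputs) with horizontal and vertical composition products and actions of the symmetric groups.
The composition products are given on homogeneous elements of degrees `i`, `j` with `i + j = l`.
The actions of the symmetric groups are encoded by the operations `perm σ = σ · 1ₙ`; that is,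
`σ · f = perm σ ∘ᵥ f` and `f · σ = f ∘ᵥ perm σ`, and `perm 1` is the unit `1ₙ`. In other words,
this is a strict symmetric monoidal dg category with set of objects `ℕ`, whose symmetry
isomorphisms are the permutations of letters. -/
structure DGProp (K : Type u) [Field K] where
  /-- the complex of operations with `m` inputs and `n` outputs -/
  op (m n : ℕ) : Ch K
  /-- the vertical composition product -/
  vcomp {m k n : ℕ} {i j l : ℤ} (h : i + j = l) :
    (op k n).X i →ₗ[K] (op m k).X j →ₗ[K] (op m n).X l
  /-- the horizontal composition product -/
  hcomp {m₁ m₂ m n₁ n₂ n : ℕ} (hm : m₁ + m₂ = m) (hn : n₁ + n₂ = n) {i j l : ℤ} (h : i + j = l) :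
    (op m₁ n₁).X i →ₗ[K] (op m₂ n₂).X j →ₗ[K] (op m n).X l
  /-- the operations given by permutations -/
  perm {n : ℕ} (σ : Equiv.Perm (Fin n)) : (op n n).X 0
  d_vcomp {m k n : ℕ} {i j l i' j' l' : ℤ} (h : i + j = l) (hi : i' + 1 = i) (hj : j' + 1 = j)
    (hl : l' + 1 = l) (f : (op k n).X i) (g : (op m k).X j) :
    ((op m n).d l l').hom (vcomp h f g) =
      vcomp (by omega) (((op k n).d i i').hom f) g +
        sg K i.negOnePow • vcomp (by omega) f (((op m k).d j j').hom g)
  d_hcomp {m₁ m₂ m n₁ n₂ n : ℕ} (hm : m₁ + m₂ = m) (hn : n₁ + n₂ = n) {i j l i' j' l' : ℤ}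
    (h : i + j = l) (hi : i' + 1 = i) (hj : j' + 1 = j) (hl : l' + 1 = l)
    (f : (op m₁ n₁).X i) (g : (op m₂ n₂).X j) :
    ((op m n).d l l').hom (hcomp hm hn h f g) =
      hcomp hm hn (by omega) (((op m₁ n₁).d i i').hom f) g +
        sg K i.negOnePow • hcomp hm hn (by omega) f (((op m₂ n₂).d j j').hom g)
  d_perm {n : ℕ} (l : ℤ) (σ : Equiv.Perm (Fin n)) : ((op n n).d 0 l).hom (perm σ) = 0
  vcomp_assoc {m p q n : ℕ} {i j k ij jk l : ℤ} (hij : i + j = ij) (hjk : j + k = jk)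
    (h : ij + k = l) (h' : i + jk = l) (f₁ : (op q n).X i) (f₂ : (op p q).X j)
    (f₃ : (op m p).X k) :
    vcomp h (vcomp hij f₁ f₂) f₃ = vcomp h' f₁ (vcomp hjk f₂ f₃)
  hcomp_assoc {m₁ m₂ m₃ m₁₂ m₂₃ m n₁ n₂ n₃ n₁₂ n₂₃ n : ℕ} (hm₁₂ : m₁ + m₂ = m₁₂)
    (hm₂₃ : m₂ + m₃ = m₂₃) (hm : m₁₂ + m₃ = m) (hm' : m₁ + m₂₃ = m) (hn₁₂ : n₁ + n₂ = n₁₂)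
    (hn₂₃ : n₂ + n₃ = n₂₃) (hn : n₁₂ + n₃ = n) (hn' : n₁ + n₂₃ = n) {i j k ij jk l : ℤ}
    (hij : i + j = ij) (hjk : j + k = jk) (h : ij + k = l) (h' : i + jk = l)
    (f₁ : (op m₁ n₁).X i) (f₂ : (op m₂ n₂).X j) (f₃ : (op m₃ n₃).X k) :
    hcomp hm hn h (hcomp hm₁₂ hn₁₂ hij f₁ f₂) f₃ = hcomp hm' hn' h' f₁ (hcomp hm₂₃ hn₂₃ hjk f₂ f₃)
  exchange {m₁ m₂ m k₁ k₂ k n₁ n₂ n : ℕ} (hm : m₁ + m₂ = m) (hk : k₁ + k₂ = k) (hn : n₁ + n₂ = n)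
    {i₁ i₂ j₁ j₂ i j e₁ e₂ l : ℤ} (hi : i₁ + i₂ = i) (hj : j₁ + j₂ = j) (he₁ : i₁ + j₁ = e₁)
    (he₂ : i₂ + j₂ = e₂) (h : i + j = l) (h' : e₁ + e₂ = l) (f₁ : (op k₁ n₁).X i₁)
    (f₂ : (op k₂ n₂).X i₂) (g₁ : (op m₁ k₁).X j₁) (g₂ : (op m₂ k₂).X j₂) :
    vcomp h (hcomp hk hn hi f₁ f₂) (hcomp hm hk hj g₁ g₂) =
      sg K (i₂ * j₁).negOnePow • hcomp hm hn h' (vcomp he₁ f₁ g₁) (vcomp he₂ f₂ g₂)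
  one_vcomp {m n : ℕ} {i : ℤ} (f : (op m n).X i) : vcomp (zero_add i) (perm 1) f = f
  vcomp_one {m n : ℕ} {i : ℤ} (f : (op m n).X i) : vcomp (add_zero i) f (perm 1) = f
  one_hcomp {m n : ℕ} {i : ℤ} (f : (op m n).X i) :
    hcomp (zero_add m) (zero_add n) (zero_add i) (perm (1 : Equiv.Perm (Fin 0))) f = f
  hcomp_one {m n : ℕ} {i : ℤ} (f : (op m n).X i) :
    hcomp (add_zero m) (add_zero n) (add_zero i) f (perm (1 : Equiv.Perm (Fin 0))) = f
  perm_mul {n : ℕ} (σ τ : Equiv.Perm (Fin n)) :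
    perm (σ * τ) = vcomp (zero_add 0) (perm σ) (perm τ)
  hcomp_perm {n₁ n₂ n : ℕ} (hn : n₁ + n₂ = n) (σ : Equiv.Perm (Fin n₁))
    (τ : Equiv.Perm (Fin n₂)) :
    hcomp hn hn (zero_add 0) (perm σ) (perm τ) = perm (blockSum hn σ τ)
  hcomp_swap {m₁ m₂ m n₁ n₂ n : ℕ} (hm : m₁ + m₂ = m) (hm' : m₂ + m₁ = m) (hn : n₁ + n₂ = n)
    (hn' : n₂ + n₁ = n) {i j l : ℤ} (h : i + j = l) (h' : j + i = l) (f : (op m₁ n₁).X i)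
    (g : (op m₂ n₂).X j) :
    vcomp (zero_add l) (perm (blockSwap hn)) (hcomp hm hn h f g) =
      sg K (i * j).negOnePow •
        vcomp (add_zero l) (hcomp hm' hn' h' g f) (perm (blockSwap hm))

section EndProp
variable {K : Type u} [Field K]

theorem homDeg_tpJoin_ext {X : Ch K} {m₁ m₂ m n : ℕ} {l : ℤ} (hm : m₁ + m₂ = m)
    {φ ψ : homDeg X m n l}
    (H : ∀ (a b : ℤ) (u : TP X m₁) (v : TP X m₂), u ∈ tpDeg X m₁ a → v ∈ tpDeg X m₂ b →
      φ.1 (tpJoin X hm u v) = ψ.1 (tpJoin X hm u v)) : φ = ψ :=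
  Subtype.ext (tpJoin_ext hm H)

theorem homD_vcomp (X : Ch K) {m k n : ℕ} {i j l i' j' l' : ℤ} (h : i + j = l) (hi : i' + 1 = i)
    (hj : j' + 1 = j) (hl : l' + 1 = l) (h₁ : i' + j = l') (h₂ : i + j' = l')
    (f : homDeg X k n i) (g : homDeg X m k j) :
    homD X m n hl (homVcomp X h f g) = homVcomp X h₁ (homD X k n hi f) g +
      sg K i.negOnePow • homVcomp X h₂ f (homD X m k hj g) := by
  refine Subtype.ext (LinearMap.ext fun t => ?_)
  change tpD X n (f.1 (g.1 t)) - sg K l.negOnePow • f.1 (g.1 (tpD X m t)) =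
    (tpD X n (f.1 (g.1 t)) - sg K i.negOnePow • f.1 (tpD X k (g.1 t))) +
      sg K i.negOnePow • f.1 (tpD X k (g.1 t) - sg K j.negOnePow • g.1 (tpD X m t))
  rw [map_sub, map_smul, smul_sub, sg_smul_sg, ← Int.negOnePow_add, h]
  abel

theorem homD_hcomp (X : Ch K) {m₁ m₂ m n₁ n₂ n : ℕ} (hm : m₁ + m₂ = m) (hn : n₁ + n₂ = n)
    {i j l i' j' l' : ℤ} (h : i + j = l) (hi : i' + 1 = i) (hj : j' + 1 = j) (hl : l' + 1 = l)
    (h₁ : i' + j = l') (h₂ : i + j' = l') (f : homDeg X m₁ n₁ i) (g : homDeg X m₂ n₂ j) :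
    homD X m n hl (homHcomp X hm hn h f g) = homHcomp X hm hn h₁ (homD X m₁ n₁ hi f) g +
      sg K i.negOnePow • homHcomp X hm hn h₂ f (homD X m₂ n₂ hj g) := by
  refine homDeg_tpJoin_ext hm fun a b u v hu hv => ?_
  change tpD X n (homTensor X hm hn j f.1 g.1 (tpJoin X hm u v)) -
      sg K l.negOnePow • homTensor X hm hn j f.1 g.1 (tpD X m (tpJoin X hm u v)) =
    homTensor X hm hn j (homD X m₁ n₁ hi f).1 g.1 (tpJoin X hm u v) +
      sg K i.negOnePow • homTensor X hm hn j' f.1 (homD X m₂ n₂ hj g).1 (tpJoin X hm u v)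
  have hdu : tpD X m₁ u ∈ tpDeg X m₁ (a - 1) := tpD_mem (by omega) hu
  have e1 : (homD X m₁ n₁ hi f).1 u = tpD X n₁ (f.1 u) - sg K i.negOnePow • f.1 (tpD X m₁ u) := rfl
  have e2 : (homD X m₂ n₂ hj g).1 v = tpD X n₂ (g.1 v) - sg K j.negOnePow • g.1 (tpD X m₂ v) := rfl
  rw [tpJoin_tpD_of_mem hm hu, map_add, map_smul, homTensor_tpJoin hm hn _ _ hu,
    homTensor_tpJoin hm hn _ _ hu, homTensor_tpJoin hm hn _ _ hu,
    homTensor_tpJoin hm hn _ _ hu, homTensor_tpJoin hm hn _ _ hdu, map_smul,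
    tpJoin_tpD_of_mem hn (f.2 a _ rfl u hu), e1, e2]
  simp only [← tpJoinₗ_apply, map_sub, LinearMap.sub_apply, map_smul, LinearMap.smul_apply,
    smul_add, smul_sub, sg_smul_sg, ← Int.negOnePow_add]
  have s₁ : (l + (a - 1) * j).negOnePow = (a * j + i).negOnePow :=
    (Int.negOnePow_eq_iff _ _).2 ⟨0, by rw [← h]; ring⟩
  have s₂ : (a * j + (a + i)).negOnePow = (i + a * j').negOnePow :=
    (Int.negOnePow_eq_iff _ _).2 ⟨a, by rw [← hj]; ring⟩
  have s₃ : (l + (a + a * j)).negOnePow = (i + (a * j' + j)).negOnePow :=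
    (Int.negOnePow_eq_iff _ _).2 ⟨a, by rw [← h, ← hj]; ring⟩
  rw [s₁, s₂, s₃]
  abel

/-- The endomorphism prop of a chain complex `X`, with `End_X(m, n) = Hom(X^{⊗ m}, X^{⊗ n})`. -/
noncomputable def endProp (X : Ch K) : DGProp K where
  op := homComplex X
  vcomp h := homVcomp X h
  hcomp hm hn _ _ _ h := homHcomp X hm hn h
  perm σ := homPerm X σ
  d_vcomp := by
    intro m k n i j l i' j' l' h hi hj hl f g
    simp only [homComplex, dif_pos hi, dif_pos hj, dif_pos hl]
    exact homD_vcomp X h hi hj hl (by omega) (by omega) f g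
  d_hcomp := by
    intro m₁ m₂ m n₁ n₂ n hm hn i j l i' j' l' h hi hj hl f g
    simp only [homComplex, dif_pos hi, dif_pos hj, dif_pos hl]
    exact homD_hcomp X hm hn h hi hj hl (by omega) (by omega) f g
  d_perm := by
    intro n l σ
    by_cases hl : l + 1 = 0
    · simp only [homComplex, dif_pos hl]
      refine Subtype.ext (LinearMap.ext fun t => ?_)
      change tpD X n (tpPerm X σ t) - sg K (0 : ℤ).negOnePow • tpPerm X σ (tpD X n t) = 0
      rw [tpD_tpPerm, Int.negOnePow_zero, sg_one, one_smul, sub_self]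
    · simp only [homComplex, dif_neg hl]
      rfl
  vcomp_assoc := by
    intros
    rfl
  hcomp_assoc := by
    intro m₁ m₂ m₃ m₁₂ m₂₃ m n₁ n₂ n₃ n₁₂ n₂₃ n hm₁₂ hm₂₃ hm hm' hn₁₂ hn₂₃ hn hn' i j k ij jk l
      hij hjk h h' f₁ f₂ f₃
    refine Subtype.ext (tp_ext fun a y hy => ?_)
    rw [tprod_eq_tpJoin hm, tprod_eq_tpJoin hm₁₂]
    have hu := tprod_mem (X := X) _ (fun j => y (blockEquiv hm (Sum.inl
      (blockEquiv hm₁₂ (Sum.inl j))))) rfl fun j => hy _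
    have hv := tprod_mem (X := X) _ (fun j => y (blockEquiv hm (Sum.inl
      (blockEquiv hm₁₂ (Sum.inr j))))) rfl fun j => hy _
    generalize PiTensorProduct.tprod K (fun j => y (blockEquiv hm (Sum.inl
      (blockEquiv hm₁₂ (Sum.inl j))))) = u at hu ⊢
    generalize PiTensorProduct.tprod K (fun j => y (blockEquiv hm (Sum.inl
      (blockEquiv hm₁₂ (Sum.inr j))))) = v at hv ⊢
    generalize PiTensorProduct.tprod K (fun j => y (blockEquiv hm (Sum.inr j))) = w
    change homTensor X hm hn k (homTensor X hm₁₂ hn₁₂ j f₁.1 f₂.1) f₃.1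
        (tpJoin X hm (tpJoin X hm₁₂ u v) w) =
      homTensor X hm' hn' jk f₁.1 (homTensor X hm₂₃ hn₂₃ k f₂.1 f₃.1)
        (tpJoin X hm (tpJoin X hm₁₂ u v) w)
    rw [homTensor_tpJoin hm hn _ _ (tpJoin_mem hm₁₂ rfl hu hv), homTensor_tpJoin hm₁₂ hn₁₂ _ _ hu,
      tpJoin_assoc hm₁₂ hm₂₃ hm hm', homTensor_tpJoin hm' hn' _ _ hu,
      homTensor_tpJoin hm₂₃ hn₂₃ _ _ hv, tpJoin_smul_left, tpJoin_smul_right,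
      tpJoin_assoc hn₁₂ hn₂₃ hn hn', sg_smul_sg, sg_smul_sg, ← Int.negOnePow_add,
      ← Int.negOnePow_add, ← hjk]
    congr 3
    ring
  exchange := by
    intro m₁ m₂ m k₁ k₂ k n₁ n₂ n hm hk hn i₁ i₂ j₁ j₂ i j e₁ e₂ l hi hj he₁ he₂ h h' f₁ f₂ g₁ g₂
    refine homDeg_tpJoin_ext hm fun a b u v hu hv => ?_
    change homTensor X hk hn i₂ f₁.1 f₂.1 (homTensor X hm hk j₂ g₁.1 g₂.1 (tpJoin X hm u v)) =
      sg K (i₂ * j₁).negOnePow •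
        homTensor X hm hn e₂ (f₁.1 ∘ₗ g₁.1) (f₂.1 ∘ₗ g₂.1) (tpJoin X hm u v)
    rw [homTensor_tpJoin hm hk _ _ hu, map_smul, homTensor_tpJoin hk hn _ _ (g₁.2 a _ rfl u hu),
      homTensor_tpJoin hm hn _ _ hu, sg_smul_sg, sg_smul_sg, ← Int.negOnePow_add,
      ← Int.negOnePow_add, ← he₂]
    congr 3
    ring
  one_vcomp f := Subtype.ext (LinearMap.ext fun t => tpPerm_one _)
  vcomp_one f := Subtype.ext (LinearMap.ext fun t => congrArg f.1 (tpPerm_one _))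
  one_hcomp := by
    intro m n i f
    refine Subtype.ext (LinearMap.ext fun t => ?_)
    change homTensor X _ _ i (tpPerm X (1 : Equiv.Perm (Fin 0))) f.1 t = f.1 t
    have hy : PiTensorProduct.tprod K (fun j : Fin 0 => (0 : Tot X)) ∈ tpDeg X 0 0 :=
      tprod_mem (fun _ => 0) _ (by simp) fun j => j.elim0
    rw [← tpJoin_unit_left (zero_add m) (fun _ => 0) t, homTensor_tpJoin _ _ _ _ hy, tpPerm_one,
      tpJoin_unit_left, tpJoin_unit_left, zero_mul, Int.negOnePow_zero, sg_one, one_smul]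
  hcomp_one := by
    intro m n i f
    refine Subtype.ext (tp_ext fun a y hy => ?_)
    change homTensor X _ _ 0 f.1 (tpPerm X (1 : Equiv.Perm (Fin 0))) _ = f.1 _
    rw [← tpJoin_unit_right (add_zero m) (fun _ => 0) (PiTensorProduct.tprod K y),
      homTensor_tpJoin _ _ _ _ (tprod_mem a y rfl hy), tpPerm_one, tpJoin_unit_right,
      tpJoin_unit_right, mul_zero, Int.negOnePow_zero, sg_one, one_smul]
  perm_mul σ τ := Subtype.ext (LinearMap.ext fun t => tpPerm_mul σ τ t)
  hcomp_perm := by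
    intro n₁ n₂ n hn σ τ
    refine homDeg_tpJoin_ext hn fun a b u v hu hv => ?_
    change homTensor X hn hn 0 (tpPerm X σ) (tpPerm X τ) (tpJoin X hn u v) =
      tpPerm X (blockSum hn σ τ) (tpJoin X hn u v)
    rw [homTensor_tpJoin hn hn _ _ hu, tpPerm_blockSum, mul_zero, Int.negOnePow_zero, sg_one,
      one_smul]
  hcomp_swap := by
    intro m₁ m₂ m n₁ n₂ n hm hm' hn hn' i j l h h' f g
    refine homDeg_tpJoin_ext hm fun a b u v hu hv => ?_
    change tpPerm X (blockSwap hn) (homTensor X hm hn j f.1 g.1 (tpJoin X hm u v)) =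
      sg K (i * j).negOnePow •
        homTensor X hm' hn' i g.1 f.1 (tpPerm X (blockSwap hm) (tpJoin X hm u v))
    rw [homTensor_tpJoin hm hn _ _ hu, map_smul, tpPerm_blockSwap hm hm' hu hv, map_smul,
      homTensor_tpJoin hm' hn' _ _ hv,
      tpPerm_blockSwap hn hn' (f.2 a _ rfl u hu) (g.2 b _ rfl v hv), sg_smul_sg, sg_smul_sg,
      sg_smul_sg, ← Int.negOnePow_add, ← Int.negOnePow_add, ← Int.negOnePow_add]
    congr 2
    rw [Int.negOnePow_eq_iff]
    exact ⟨a * j, by ring⟩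

end EndProp

section Props
variable {K : Type u} [Field K]

/-- Morphisms of dg props: families of chain maps that preserve the composition products and the
operations given by permutations (hence the units and the actions of the symmetric groups). -/
@[ext]
structure DGProp.Hom (P Q : DGProp K) where
  /-- the underlying chain maps -/
  app (m n : ℕ) : P.op m n ⟶ Q.op m n
  map_vcomp {m k n : ℕ} {i j l : ℤ} (h : i + j = l) (f : (P.op k n).X i) (g : (P.op m k).X j) :
    ((app m n).f l).hom (P.vcomp h f g) =
      Q.vcomp h (((app k n).f i).hom f) (((app m k).f j).hom g)
  map_hcomp {m₁ m₂ m n₁ n₂ n : ℕ} (hm : m₁ + m₂ = m) (hn : n₁ + n₂ = n) {i j l : ℤ}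
    (h : i + j = l) (f : (P.op m₁ n₁).X i) (g : (P.op m₂ n₂).X j) :
    ((app m n).f l).hom (P.hcomp hm hn h f g) =
      Q.hcomp hm hn h (((app m₁ n₁).f i).hom f) (((app m₂ n₂).f j).hom g)
  map_perm {n : ℕ} (σ : Equiv.Perm (Fin n)) : ((app n n).f 0).hom (P.perm σ) = Q.perm σ

instance : Category (DGProp K) where
  Hom := DGProp.Hom
  id P := { app := fun m n => 𝟙 _
            map_vcomp := fun _ _ _ => rfl
            map_hcomp := fun _ _ _ _ _ _ _ _ => rfl
            map_perm := fun _ => rfl }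
  comp φ ψ :=
    { app := fun m n => φ.app m n ≫ ψ.app m n
      map_vcomp := fun h f g =>
        (congrArg _ (φ.map_vcomp h f g)).trans (ψ.map_vcomp h _ _)
      map_hcomp := fun hm hn _ _ _ h f g =>
        (congrArg _ (φ.map_hcomp hm hn h f g)).trans (ψ.map_hcomp hm hn h _ _)
      map_perm := fun σ => (congrArg _ (φ.map_perm σ)).trans (ψ.map_perm σ) }

/-- The acyclic fibrations of dg props: the morphisms that are surjective quasi-isomorphisms
componentwise. -/
def DGProp.acyclicFibrations (K : Type u) [Field K] : MorphismProperty (DGProp K) :=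
  fun _ _ φ => ∀ m n, (∀ k, Function.Surjective ((DGProp.Hom.app φ m n).f k)) ∧
    QuasiIso (DGProp.Hom.app φ m n)

/-- A dg prop is cofibrant if the morphism from the initial dg prop has the left lifting property
with respect to acyclic fibrations, i.e. if every morphism from it lifts through every acyclic
fibration. -/
def DGProp.IsCofibrant (P : DGProp K) : Prop :=
  ∀ ⦃Q R : DGProp K⦄ (q : Q ⟶ R), DGProp.acyclicFibrations K q → ∀ φ : P ⟶ R,
    ∃ ψ : P ⟶ Q, ψ ≫ q = φ

/-- A dg prop without non-zero operations with inputs but without outputs. -/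
def DGProp.NonemptyOutputs (P : DGProp K) : Prop :=
  ∀ m, m ≠ 0 → ∀ k, Subsingleton ((P.op m 0).X k)

/-- An algebra over a dg prop `P`: a chain complex `X` with a morphism of props `P ⟶ End_X`. -/
structure Alg (P : DGProp K) where
  /-- the underlying chain complex -/
  X : Ch K
  /-- the structure morphism -/
  str : P ⟶ endProp X

/-- The map `X^{⊗ m} → X^{⊗ n}` given by the action of an operation. -/
noncomputable def Alg.act {P : DGProp K} (A : Alg P) {m n : ℕ} {k : ℤ} (p : (P.op m n).X k) :
    TP A.X m →ₗ[K] TP A.X n :=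
  (show homDeg A.X m n k from ((DGProp.Hom.app A.str m n).f k).hom p).1

/-- Morphisms of algebras: chain maps that commute with the action of the operations. -/
@[ext]
structure Alg.Hom {P : DGProp K} (A B : Alg P) where
  /-- the underlying chain map -/
  f : A.X ⟶ B.X
  comm {m n : ℕ} {k : ℤ} (p : (P.op m n).X k) : tpMap f n ∘ₗ A.act p = B.act p ∘ₗ tpMap f m

theorem totMap_id (X : Ch K) : totMap (𝟙 X) = LinearMap.id :=
  tot_ext fun i x => by simp [totMap, totDesc_tin]

theorem totMap_comp {X Y Z : Ch K} (f : X ⟶ Y) (g : Y ⟶ Z) :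
    totMap (f ≫ g) = totMap g ∘ₗ totMap f :=
  tot_ext fun i x => by simp [totMap, totDesc_tin]

theorem tpMap_id (X : Ch K) (n : ℕ) : tpMap (𝟙 X) n = LinearMap.id := by
  rw [tpMap, totMap_id, PiTensorProduct.map_id]

theorem tpMap_comp {X Y Z : Ch K} (f : X ⟶ Y) (g : Y ⟶ Z) (n : ℕ) :
    tpMap (f ≫ g) n = tpMap g n ∘ₗ tpMap f n := by
  rw [tpMap, totMap_comp, PiTensorProduct.map_comp, tpMap, tpMap]

instance (P : DGProp K) : Category (Alg P) where
  Hom := Alg.Hom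
  id A := { f := 𝟙 A.X
            comm := fun p => by
              rw [tpMap_id, tpMap_id, LinearMap.id_comp, LinearMap.comp_id] }
  comp φ ψ := { f := φ.f ≫ ψ.f
                comm := fun p => by
                  rw [tpMap_comp, tpMap_comp, LinearMap.comp_assoc, φ.comm, ← LinearMap.comp_assoc,
                    ψ.comm, LinearMap.comp_assoc] }

/-- The forgetful functor from algebras to chain complexes. -/
def Alg.forget (P : DGProp K) : Alg P ⥤ Ch K where
  obj A := A.X
  map φ := Alg.Hom.f φ

/-- The acyclic injections: the morphisms of algebras whose underlying chain map is an injective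
quasi-isomorphism. -/
def Alg.acyclicInjections (P : DGProp K) : MorphismProperty (Alg P) :=
  fun _ _ φ => (∀ k, Function.Injective ((Alg.Hom.f φ).f k)) ∧ QuasiIso (Alg.Hom.f φ)

/-- The surjections: the morphisms of algebras whose underlying chain map is surjective. -/
def Alg.surjections (P : DGProp K) : MorphismProperty (Alg P) :=
  fun _ _ φ => ∀ k, Function.Surjective ((Alg.Hom.f φ).f k)

end Props

section Factorization
variable {K : Type u} [Field K]

/-- The differential `(x, y', y) ↦ (d x, f x - d y' - y, d y)` of the twisted sum. -/
noncomputable def twD {X Y : Ch K} (f : X ⟶ Y) {k l : ℤ} (h : l + 1 = k) :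
    (X.X k × Y.X (k + 1) × Y.X k) →ₗ[K] (X.X l × Y.X (l + 1) × Y.X l) where
  toFun z := ((X.d k l).hom z.1,
    (Y.XIsoOfEq h.symm).hom.hom ((f.f k).hom z.1) - (Y.d (k + 1) (l + 1)).hom z.2.1 -
      (Y.XIsoOfEq h.symm).hom.hom z.2.2,
    (Y.d k l).hom z.2.2)
  map_add' z z' := by
    ext
    · simp
    · simp only [Prod.fst_add, Prod.snd_add, map_add]
      abel
    · simp
  map_smul' c z := by
    ext <;> simp [smul_sub]

/-- The twisted sum `Z = (K e₀ ⊗ X ⊕ K e₀₁ ⊗ Y ⊕ K e₁ ⊗ Y, d_Z)` associated to a chain map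
`f : X ⟶ Y`, where `e₀`, `e₁` have degree `0` and `e₀₁` has degree `-1` (so that `Z` in degree `k`
is `X_k ⊕ Y_{k + 1} ⊕ Y_k`). -/
noncomputable def tw {X Y : Ch K} (f : X ⟶ Y) : Ch K where
  X k := ModuleCat.of K (X.X k × Y.X (k + 1) × Y.X k)
  d k l := if h : l + 1 = k then ModuleCat.ofHom (twD f h) else 0
  shape k l h := dif_neg h
  d_comp_d' i j k hij hjk := by
    change j + 1 = i at hij
    change k + 1 = j at hjk
    subst hjk
    subst hij
    rw [dif_pos rfl, dif_pos rfl]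
    have hX (x : X.X (k + 1 + 1)) :
        (X.d (k + 1) k).hom ((X.d (k + 1 + 1) (k + 1)).hom x) = 0 := by
      rw [← LinearMap.comp_apply, ← ModuleCat.hom_comp, X.d_comp_d]
      rfl
    have hY (a b c : ℤ) (y : Y.X a) : (Y.d b c).hom ((Y.d a b).hom y) = 0 := by
      rw [← LinearMap.comp_apply, ← ModuleCat.hom_comp, Y.d_comp_d]
      rfl
    have hf (x : X.X (k + 1 + 1)) : (f.f (k + 1)).hom ((X.d (k + 1 + 1) (k + 1)).hom x) =
        (Y.d (k + 1 + 1) (k + 1)).hom ((f.f (k + 1 + 1)).hom x) := by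
      rw [← LinearMap.comp_apply, ← ModuleCat.hom_comp, ← f.comm]
      rfl
    refine ModuleCat.hom_ext (LinearMap.ext fun z => ?_)
    refine Prod.ext (hX z.1) (Prod.ext ?_ (hY _ _ _ z.2.2))
    change (f.f (k + 1)).hom ((X.d (k + 1 + 1) (k + 1)).hom z.1) -
      (Y.d (k + 1 + 1) (k + 1)).hom ((f.f (k + 1 + 1)).hom z.1 -
        (Y.d (k + 1 + 1 + 1) (k + 1 + 1)).hom z.2.1 - z.2.2) -
      (Y.d (k + 1 + 1) (k + 1)).hom z.2.2 = 0
    rw [hf, map_sub, map_sub, hY]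
    abel

theorem tw_d {X Y : Ch K} (f : X ⟶ Y) {k l : ℤ} (h : l + 1 = k) :
    (tw f).d k l = ModuleCat.ofHom (twD f h) := dif_pos h

theorem hom_comm_apply {X Y : Ch K} (f : X ⟶ Y) (k l : ℤ) (x : X.X k) :
    (f.f l).hom ((X.d k l).hom x) = (Y.d k l).hom ((f.f k).hom x) := by
  rw [← LinearMap.comp_apply, ← ModuleCat.hom_comp, ← f.comm]
  rfl

/-- The map `(x, y', y) ↦ (a x, b y', b y)` between twisted sums induced by a commutative square. -/
noncomputable def twMap {X Y X' Y' : Ch K} (f : X ⟶ Y) (f' : X' ⟶ Y') (a : X ⟶ X') (b : Y ⟶ Y')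
    (w : a ≫ f' = f ≫ b) : tw f ⟶ tw f' where
  f k := ModuleCat.ofHom (Y := X'.X k × Y'.X (k + 1) × Y'.X k)
    (LinearMap.prodMap (a.f k).hom (LinearMap.prodMap (b.f (k + 1)).hom (b.f k).hom))
  comm' k l hkl := by
    change l + 1 = k at hkl
    subst hkl
    have hw (x : X.X (l + 1)) : (f'.f (l + 1)).hom ((a.f (l + 1)).hom x) =
        (b.f (l + 1)).hom ((f.f (l + 1)).hom x) :=
      congrArg (fun g : X ⟶ Y' => (g.f (l + 1)).hom x) w
    rw [tw_d f rfl, tw_d f' rfl]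
    refine ModuleCat.hom_ext (LinearMap.ext fun z => ?_)
    refine Prod.ext (hom_comm_apply a _ _ z.1).symm
      (Prod.ext ?_ (hom_comm_apply b _ _ z.2.2).symm)
    change (f'.f (l + 1)).hom ((a.f (l + 1)).hom z.1) -
      (Y'.d (l + 1 + 1) (l + 1)).hom ((b.f (l + 1 + 1)).hom z.2.1) - (b.f (l + 1)).hom z.2.2 =
      (b.f (l + 1)).hom ((f.f (l + 1)).hom z.1 - (Y.d (l + 1 + 1) (l + 1)).hom z.2.1 - z.2.2)
    rw [map_sub, map_sub, hom_comm_apply, hw]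

/-- The functor `f ↦ Z` from arrows of chain complexes to chain complexes. -/
noncomputable def twFunctor (K : Type u) [Field K] : Arrow (Ch K) ⥤ Ch K where
  obj f := tw f.hom
  map {f g} φ := twMap f.hom g.hom φ.left φ.right φ.w
  map_id _ := rfl
  map_comp _ _ := rfl

/-- The map `i : X ⟶ Z`, `x ↦ (x, 0, f x)`. -/
noncomputable def twIncl {X Y : Ch K} (f : X ⟶ Y) : X ⟶ tw f where
  f k := ModuleCat.ofHom (Y := X.X k × Y.X (k + 1) × Y.X k)
    (LinearMap.prod LinearMap.id (LinearMap.prod 0 (f.f k).hom))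
  comm' k l hkl := by
    change l + 1 = k at hkl
    subst hkl
    rw [tw_d f rfl]
    refine ModuleCat.hom_ext (LinearMap.ext fun x => ?_)
    refine Prod.ext rfl (Prod.ext ?_ (hom_comm_apply f _ _ x).symm)
    change (f.f (l + 1)).hom x - (Y.d (l + 1 + 1) (l + 1)).hom 0 - (f.f (l + 1)).hom x = 0
    rw [map_zero, sub_zero, sub_self]

/-- The map `s : Z ⟶ X`, `(x, y', y) ↦ x`. -/
noncomputable def twFst {X Y : Ch K} (f : X ⟶ Y) : tw f ⟶ X where
  f k := ModuleCat.ofHom (X := X.X k × Y.X (k + 1) × Y.X k) (LinearMap.fst K _ _)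
  comm' k l hkl := by
    change l + 1 = k at hkl
    rw [tw_d f hkl]
    rfl

/-- The map `p : Z ⟶ Y`, `(x, y', y) ↦ y`. -/
noncomputable def twProj {X Y : Ch K} (f : X ⟶ Y) : tw f ⟶ Y where
  f k := ModuleCat.ofHom (X := X.X k × Y.X (k + 1) × Y.X k)
    (LinearMap.snd K _ _ ∘ₗ LinearMap.snd K _ _)
  comm' k l hkl := by
    change l + 1 = k at hkl
    rw [tw_d f hkl]
    rfl

/-- The maps `i` form a natural transformation. -/
noncomputable def twI (K : Type u) [Field K] : Arrow.leftFunc ⟶ twFunctor K where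
  app f := twIncl f.hom
  naturality f g φ := by
    refine HomologicalComplex.hom_ext _ _ fun k => ModuleCat.hom_ext (LinearMap.ext fun x => ?_)
    refine Prod.ext rfl (Prod.ext ?_ ?_)
    · exact (map_zero (φ.right.f (k + 1)).hom).symm
    · exact congrArg (fun h : f.left ⟶ g.right => (h.f k).hom x) φ.w

/-- The maps `s` form a natural transformation. -/
noncomputable def twS (K : Type u) [Field K] : twFunctor K ⟶ Arrow.leftFunc where
  app f := twFst f.hom
  naturality _ _ _ := rfl

/-- The maps `p` form a natural transformation. -/
noncomputable def twP (K : Type u) [Field K] : twFunctor K ⟶ Arrow.rightFunc where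
  app f := twProj f.hom
  naturality _ _ _ := rfl

end Factorization

end DG

/-! Consider pairs consisting of an operation `a` of `P` and a family of operations `x_f` on `Z(f)`,
one for each morphism `f` of `P`-algebras, such that `x_f` is natural in `f` and commutes with the
action of `a` on source and target along `i` and `p`. Such pairs form a dg prop over `P`. A section
of its projection to `P` is exactly a functorial `P`-algebra structure on all `Z(f)` for which `i`
and `p` are morphisms. As `P` is cofibrant, a section exists as soon as the projection is an acyclic
fibration (`twProj_mem_acyclicFibrations`).

Surjectivity: omitting tensor powers from the notation, `a` has the lift `i a s + σ a p (1 - i s)`,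
where `σ y = (0, 0, y)` is a graded section of `p` (`twOp`). It restricts to `a` along `i` because
`s i = 1`, and it lies over `a` along `p` because `f` is a morphism of algebras. It need not commute
with differentials: surjectivity concerns each degree separately.

Acyclicity of the kernel: `(x, y', y) ↦ (0, 0, -y')` is a natural homotopy from `i s` to the
identity of `Z(f)` that vanishes on the image of `i`. It induces a homotopy `H` with the same
properties on the tensor powers (`tpD_tpDer_add`). An `x` in the kernel satisfies `x i = 0`, so if
it is a cycle then `d (x H) = ± x (1 - i s) = ± x` (`homD_twContract`). The family `x H` is again
natural and in the kernel: `x H i = 0` since `H i = 0`, and `p x H = 0` since `p x = 0`.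

Two refinements. The morphisms of algebras form a large set, so the families are restricted to the
subprop generated by the lifts and closed under the contraction. It consists of the values of formal
expressions, hence is small, and the compatibilities hold on it by induction on expressions
(`intertwines_of_mem_closure`). Moreover `s σ = 0`, so the lifts also commute with `s` in arities
with outputs; without inputs and outputs they do so because `1 - i s` vanishes on the zeroth tensor
power. Only operations with inputs and no outputs could obstruct the lifting of `s`. -/

namespace DG
variable {K : Type u} [Field K]

/-! ### Quasi-isomorphisms: the maps `s` and `i` -/

/-- A surjective chain map is a quasi-isomorphism if its kernel is acyclic. -/
theorem quasiIso_of_surjective {X Y : Ch K} (f : X ⟶ Y)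
    (hf : ∀ k, Function.Surjective (f.f k))
    (hker : ∀ k l m (_ : m + 1 = l) (_ : l + 1 = k) (x : X.X l), (f.f l).hom x = 0 →
      (X.d l m).hom x = 0 → ∃ z : X.X k, (f.f k).hom z = 0 ∧ (X.d k l).hom z = x) :
    QuasiIso f := by
  have hepi (k : ℤ) : Epi (f.f k) := (ModuleCat.epi_iff_surjective _).2 (hf k)
  have : Epi f := HomologicalComplex.epi_of_epi_f f hepi
  let S : ShortComplex (Ch K) := ShortComplex.mk (Limits.kernel.ι f) f (Limits.kernel.condition f)
  have hS : S.ShortExact := { exact := S.exact_of_f_is_kernel (Limits.kernelIsKernel f) }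
  have hinj (k : ℤ) : Function.Injective ((Limits.kernel.ι f).f k).hom :=
    (ModuleCat.mono_iff_injective _).1
      (inferInstanceAs (Mono ((HomologicalComplex.eval _ _ k).map (Limits.kernel.ι f))))
  -- Evaluation in a degree is exact, so the abstract kernel has the expected elements.
  have hlift (k : ℤ) (x : X.X k) (hx : (f.f k).hom x = 0) :
      ∃ z, ((Limits.kernel.ι f).f k).hom z = x := by
    have he : (S.map (HomologicalComplex.eval _ _ k)).Exact :=
      hS.exact.map (HomologicalComplex.eval _ _ k)
    exact (ShortComplex.moduleCat_exact_iff _).1 he x hx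
  have hacyc (l : ℤ) : Limits.IsZero (S.X₁.homology l) := by
    refine HomologicalComplex.ExactAt.isZero_homology ?_
    rw [HomologicalComplex.exactAt_iff' _ (l + 1) l (l - 1) (by simp) (by simp),
      ShortComplex.moduleCat_exact_iff]
    intro (x : (Limits.kernel f).X l) (hx : ((Limits.kernel f).d l (l - 1)).hom x = 0)
    obtain ⟨z, hz, hdz⟩ := hker (l + 1) l (l - 1) (by omega) rfl
      (((Limits.kernel.ι f).f l).hom x)
      (congrArg (fun g => (g.f l).hom x) (Limits.kernel.condition f))
      (by rw [← hom_comm_apply, hx, map_zero])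
    obtain ⟨w, rfl⟩ := hlift _ z hz
    refine ⟨w, hinj l ?_⟩
    rw [← hdz, ← hom_comm_apply]
    rfl
  rw [quasiIso_iff]
  intro l
  rw [quasiIsoAt_iff_isIso_homologyMap]
  -- The long exact sequence: the homology of the kernel vanishes in degree `l`, which gives
  -- injectivity, and in degree `l - 1`, which gives surjectivity.
  have h1 : Mono (HomologicalComplex.homologyMap f l) :=
    (hS.homology_exact₂ l).mono_g ((hacyc l).eq_of_src _ _)
  have h2 : Epi (HomologicalComplex.homologyMap f l) :=
    (hS.homology_exact₃ l (l - 1) (by simp)).epi_f ((hacyc (l - 1)).eq_of_tgt _ _)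
  exact isIso_of_mono_of_epi _

/-- The map `s : Z ⟶ X` is a quasi-isomorphism. -/
theorem quasiIso_twFst {X Y : Ch K} (f : X ⟶ Y) : QuasiIso (twFst f) := by
  refine quasiIso_of_surjective _ (fun k x => ⟨(x, 0, 0), rfl⟩) ?_
  rintro k l m rfl rfl ⟨x, y', y⟩ hx hd
  obtain rfl : x = 0 := hx
  rw [tw_d f rfl] at hd
  have hd' : (f.f (m + 1)).hom 0 - (Y.d (m + 1 + 1) (m + 1)).hom y' - y = 0 :=
    congrArg (fun z => z.2.1) hd
  -- A cycle `(0, y', y)` has `y = -d y'`, and this is the boundary of `(0, 0, -y')`.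
  refine ⟨((0 : X.X _), (0 : Y.X _), -y'), rfl, ?_⟩
  rw [tw_d f rfl]
  refine Prod.ext (map_zero (X.d _ _).hom) (Prod.ext ?_ ?_)
  · change (f.f (m + 1 + 1)).hom 0 - (Y.d (m + 1 + 1 + 1) (m + 1 + 1)).hom 0 - -y' = y'
    simp
  · change (Y.d (m + 1 + 1) (m + 1)).hom (-y') = y
    rw [map_zero, zero_sub] at hd'
    rw [map_neg, ← sub_eq_zero]
    exact hd'

/-- Two out of three, as `s i` is the identity and `s` is a quasi-isomorphism. -/
theorem quasiIso_twIncl {X Y : Ch K} (f : X ⟶ Y) : QuasiIso (twIncl f) := by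
  have := quasiIso_twFst f
  have h : twIncl f ≫ twFst f = 𝟙 X := rfl
  rw [← quasiIso_iff_comp_right _ (twFst f), h]
  infer_instance
-- Chain maps and homotopies on tensor powers
section Intertwining
variable {K : Type u} [Field K] {X Y : Ch K}

theorem totMap_tin (f : X ⟶ Y) (i : ℤ) (x : X.X i) :
    totMap f (tin X i x) = tin Y i ((f.f i).hom x) := by
  simp [totMap, totDesc_tin]

theorem totMap_mem (f : X ⟶ Y) {i : ℤ} {y : Tot X} (hy : y ∈ totDeg X i) :
    totMap f y ∈ totDeg Y i := by
  obtain ⟨x, rfl⟩ := hy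
  exact ⟨_, (totMap_tin f i x).symm⟩

theorem totD_totMap (f : X ⟶ Y) : totD Y ∘ₗ totMap f = totMap f ∘ₗ totD X := by
  refine tot_ext fun i x => ?_
  simp only [LinearMap.comp_apply]
  rw [totMap_tin, totD_tin i (i - 1) (by omega), totD_tin i (i - 1) (by omega), totMap_tin,
    hom_comm_apply]

theorem tprod_map_mem {n : ℕ} {k : ℤ} (f : Tot X →ₗ[K] Tot Y)
    (hf : ∀ i, ∀ y ∈ totDeg X i, f y ∈ totDeg Y i) {t : TP X n} (ht : t ∈ tpDeg X n k) :
    PiTensorProduct.map (fun _ => f) t ∈ tpDeg Y n k := by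
  have : tpDeg X n k ≤ (tpDeg Y n k).comap (PiTensorProduct.map fun _ => f) := by
    refine Submodule.span_le.2 ?_
    rintro _ ⟨a, y, hk, hy, rfl⟩
    rw [SetLike.mem_coe, Submodule.mem_comap, PiTensorProduct.map_tprod]
    exact tprod_mem a _ hk fun j => hf _ _ (hy j)
  exact this ht

theorem tpMap_mem (f : X ⟶ Y) {n : ℕ} {k : ℤ} {t : TP X n} (ht : t ∈ tpDeg X n k) :
    tpMap f n t ∈ tpDeg Y n k :=
  tprod_map_mem _ (fun _ _ => totMap_mem f) ht

theorem tpMap_tprod (f : X ⟶ Y) {n : ℕ} (y : Fin n → Tot X) :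
    tpMap f n (PiTensorProduct.tprod K y) = PiTensorProduct.tprod K fun j => totMap f (y j) :=
  PiTensorProduct.map_tprod _ _

theorem totMap_totSign (f : X ⟶ Y) (k : ℤ) :
    totMap f ∘ₗ totSign X k = totSign Y k ∘ₗ totMap f := by
  refine tot_ext fun i x => ?_
  simp only [LinearMap.comp_apply]
  rw [totSign_of_mem k (totMap_mem f ⟨x, rfl⟩), totSign_of_mem k ⟨x, rfl⟩, map_smul]

/-- The map `∑ j, g ⊗ ⋯ ⊗ g ⊗ h ⊗ e ⊗ ⋯ ⊗ e` on `X^{⊗ n}`, where `h` is at the place `j`. -/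
noncomputable def tpDer (g h e : Tot X →ₗ[K] Tot X) (n : ℕ) : TP X n →ₗ[K] TP X n :=
  ∑ j : Fin n, PiTensorProduct.map fun i => if i < j then g else if i = j then h else e

theorem tpDer_tprod (g h e : Tot X →ₗ[K] Tot X) {n : ℕ} (y : Fin n → Tot X) :
    tpDer g h e n (PiTensorProduct.tprod K y) = ∑ j : Fin n, PiTensorProduct.tprod K fun i =>
      if i < j then g (y i) else if i = j then h (y i) else e (y i) := by
  simp only [tpDer, LinearMap.sum_apply, PiTensorProduct.map_tprod]
  refine Finset.sum_congr rfl fun j _ => congrArg _ (funext fun i => ?_)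
  split_ifs <;> rfl

/-- The differential of a tensor power and the homotopies below are both of the form `tpDer`, so
this one computation gives the naturality of both. -/
theorem map_comp_tpDer {g h e : Tot X →ₗ[K] Tot X} {g' h' e' : Tot Y →ₗ[K] Tot Y}
    {f : Tot X →ₗ[K] Tot Y} (hg : f ∘ₗ g = g' ∘ₗ f) (hh : f ∘ₗ h = h' ∘ₗ f)
    (he : f ∘ₗ e = e' ∘ₗ f) (n : ℕ) :
    PiTensorProduct.map (fun _ => f) ∘ₗ tpDer g h e n =
      tpDer g' h' e' n ∘ₗ PiTensorProduct.map (fun _ => f) := by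
  refine PiTensorProduct.ext (MultilinearMap.ext fun y => ?_)
  simp only [LinearMap.compMultilinearMap_apply, LinearMap.comp_apply, tpDer_tprod, map_sum,
    PiTensorProduct.map_tprod]
  refine Finset.sum_congr rfl fun j _ => congrArg _ (funext fun i => ?_)
  split_ifs
  · exact LinearMap.congr_fun hg _
  · exact LinearMap.congr_fun hh _
  · exact LinearMap.congr_fun he _

/-- Each summand contains the factor `h ∘ f`; for `n = 0` the sum is empty. -/
theorem tpDer_comp_map_eq_zero {g h e : Tot X →ₗ[K] Tot X} {f : Tot Y →ₗ[K] Tot X}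
    (hf : h ∘ₗ f = 0) (n : ℕ) : tpDer g h e n ∘ₗ PiTensorProduct.map (fun _ => f) = 0 := by
  refine PiTensorProduct.ext (MultilinearMap.ext fun y => ?_)
  simp only [LinearMap.compMultilinearMap_apply, LinearMap.comp_apply, tpDer_tprod,
    PiTensorProduct.map_tprod, LinearMap.zero_apply]
  refine Finset.sum_eq_zero fun j _ => MultilinearMap.map_coord_zero _ j ?_
  simpa using LinearMap.congr_fun hf (y j)

/-- The distinguished place lies in one of the two blocks: in the first, the second block sees only
`e`; in the second, the first block sees only `g`. This Leibniz rule drives the induction in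
`tpD_tpDer_add`. -/
theorem tpDer_tpJoin (g h e : Tot X →ₗ[K] Tot X) {m₁ m₂ m : ℕ} (hm : m₁ + m₂ = m)
    (u : TP X m₁) (v : TP X m₂) :
    tpDer g h e m (tpJoin X hm u v) =
      tpJoin X hm (tpDer g h e m₁ u) (PiTensorProduct.map (fun _ => e) v) +
        tpJoin X hm (PiTensorProduct.map (fun _ => g) u) (tpDer g h e m₂ v) := by
  have key : (tpJoinₗ X hm).compr₂ (tpDer g h e m) =
      ((tpJoinₗ X hm) ∘ₗ (tpDer g h e m₁)).compl₂ (PiTensorProduct.map fun _ => e) +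
        ((tpJoinₗ X hm) ∘ₗ (PiTensorProduct.map fun _ => g)).compl₂ (tpDer g h e m₂) := by
    refine PiTensorProduct.ext (MultilinearMap.ext fun y => ?_)
    refine PiTensorProduct.ext (MultilinearMap.ext fun z => ?_)
    simp only [LinearMap.compMultilinearMap_apply, LinearMap.compr₂_apply, LinearMap.add_apply,
      LinearMap.comp_apply, LinearMap.compl₂_apply, tpJoinₗ_apply, tpJoin_tprod, tpDer_tprod,
      PiTensorProduct.map_tprod]
    rw [← (blockEquiv hm).sum_comp, Fintype.sum_sum_type]
    simp only [← tpJoinₗ_apply, map_sum, LinearMap.sum_apply]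
    simp only [tpJoinₗ_apply, tpJoin_tprod]
    congr 1
    all_goals
      refine Finset.sum_congr rfl fun j _ => congrArg _ (funext fun i => ?_)
      obtain ⟨i, rfl⟩ := (blockEquiv hm).surjective i
      rcases i with i | i <;> simp [blockEquiv_lt]
  have := LinearMap.congr_fun (LinearMap.congr_fun key u) v
  simpa [tpJoinₗ_apply] using this

theorem tpDer_mem {h e : Tot X →ₗ[K] Tot X} (hh : ∀ i, ∀ y ∈ totDeg X i, h y ∈ totDeg X (i + 1))
    (he : ∀ i, ∀ y ∈ totDeg X i, e y ∈ totDeg X i) (n : ℕ) :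
    tpDer (totSign X 1) h e n ∈ homDeg X n n 1 := by
  rintro k l rfl t ht
  have : tpDeg X n k ≤ (tpDeg X n (k + 1)).comap (tpDer (totSign X 1) h e n) := by
    refine Submodule.span_le.2 ?_
    rintro _ ⟨a, y, hk, hy, rfl⟩
    simp only [Submodule.comap_coe, Set.mem_preimage, SetLike.mem_coe, tpDer_tprod]
    refine Submodule.sum_mem _ fun j _ => tprod_mem (Function.update a j (a j + 1)) _ ?_ ?_
    · rw [Finset.sum_update_of_mem (Finset.mem_univ j)]
      have := Finset.add_sum_erase Finset.univ a (Finset.mem_univ j)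
      rw [Finset.sdiff_singleton_eq_erase]
      omega
    · intro i
      rcases lt_trichotomy i j with hij | rfl | hij
      · rw [if_pos hij, Function.update_of_ne hij.ne]
        exact totSign_mem 1 (hy i)
      · simp only [lt_irrefl, if_false, if_true, Function.update_self]
        exact hh _ _ (hy i)
      · rw [if_neg hij.not_gt, if_neg hij.ne', Function.update_of_ne hij.ne']
        exact he _ _ (hy i)
  exact this ht

/-- By definition `tpD X n` is `tpDer (totSign X 1) (totD X) LinearMap.id n`. -/
theorem tpMap_tpD (f : X ⟶ Y) (n : ℕ) : tpMap f n ∘ₗ tpD X n = tpD Y n ∘ₗ tpMap f n :=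
  map_comp_tpDer (totMap_totSign f 1) (totD_totMap f).symm rfl n

theorem tpMap_tpPerm (f : X ⟶ Y) {n : ℕ} (σ : Equiv.Perm (Fin n)) :
    tpMap f n ∘ₗ tpPerm X σ = tpPerm Y σ ∘ₗ tpMap f n := by
  refine tp_ext fun a y hy => ?_
  simp only [LinearMap.comp_apply]
  rw [tpPerm_tprod σ hy, map_smul, tpMap_tprod, tpMap_tprod,
    tpPerm_tprod σ fun j => totMap_mem f (hy j)]

theorem map_tpJoin (f : Tot X →ₗ[K] Tot Y) {m₁ m₂ m : ℕ} (h : m₁ + m₂ = m) (u : TP X m₁)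
    (v : TP X m₂) :
    PiTensorProduct.map (fun _ => f) (tpJoin X h u v) =
      tpJoin Y h (PiTensorProduct.map (fun _ => f) u) (PiTensorProduct.map (fun _ => f) v) := by
  have : (tpJoinₗ X h).compr₂ (PiTensorProduct.map fun _ => f) =
      ((tpJoinₗ Y h) ∘ₗ (PiTensorProduct.map fun _ => f)).compl₂
        (PiTensorProduct.map fun _ => f) := by
    refine PiTensorProduct.ext (MultilinearMap.ext fun y => ?_)
    refine PiTensorProduct.ext (MultilinearMap.ext fun z => ?_)
    simp only [LinearMap.compMultilinearMap_apply, LinearMap.compr₂_apply,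
      LinearMap.comp_apply, LinearMap.compl₂_apply, tpJoinₗ_apply, tpJoin_tprod,
      PiTensorProduct.map_tprod]
    refine congrArg _ (funext fun j => ?_)
    obtain ⟨j, rfl⟩ := (blockEquiv h).surjective j
    cases j <;> simp
  exact LinearMap.congr_fun (LinearMap.congr_fun this u) v

theorem tpMap_tpJoin (f : X ⟶ Y) {m₁ m₂ m : ℕ} (h : m₁ + m₂ = m) (u : TP X m₁) (v : TP X m₂) :
    tpMap f m (tpJoin X h u v) = tpJoin Y h (tpMap f m₁ u) (tpMap f m₂ v) :=
  map_tpJoin _ h u v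

/-- If `h` is a homotopy from `e` to the identity, then so is `∑ j, 1^{⊗ j} ⊗ h ⊗ e ⊗ ⋯ ⊗ e` from
`e^{⊗ n}` to the identity (up to the signs). -/
theorem tpD_tpDer_add {h : Tot X →ₗ[K] Tot X} {f : X ⟶ X}
    (hh : ∀ i, ∀ y ∈ totDeg X i, h y ∈ totDeg X (i + 1))
    (hd : ∀ y, totD X (h y) + h (totD X y) = y - totMap f y) {n : ℕ} (t : TP X n) :
    tpD X n (tpDer (totSign X 1) h (totMap f) n t) +
      tpDer (totSign X 1) h (totMap f) n (tpD X n t) = t - tpMap f n t := by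
  induction n with
  | zero =>
    rw [tpD_zero, tpD_zero, map_zero, add_zero]
    have : tpMap f 0 = LinearMap.id := by
      refine PiTensorProduct.ext (MultilinearMap.ext fun y => ?_)
      rw [LinearMap.compMultilinearMap_apply, tpMap_tprod]
      exact congrArg _ (Subsingleton.elim _ _)
    rw [this, LinearMap.id_apply, sub_self]
  | succ n ih =>
    -- A single factor carries no signs, so this is `hd` transported along the identification `L` of
    -- `Tot X` with `TP X 1`.
    have h1 (t : TP X 1) : tpD X 1 (tpDer (totSign X 1) h (totMap f) 1 t) +
        tpDer (totSign X 1) h (totMap f) 1 (tpD X 1 t) = t - tpMap f 1 t := by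
      let L : Tot X →ₗ[K] TP X 1 :=
        (PiTensorProduct.subsingletonEquiv (R := K) (s := fun _ : Fin 1 => Tot X) 0).symm
      have hL (y : Fin 1 → Tot X) : PiTensorProduct.tprod K y = L (y 0) := by
        rw [LinearEquiv.coe_coe, LinearEquiv.eq_symm_apply]
        simp
      have e : tpD X 1 ∘ₗ tpDer (totSign X 1) h (totMap f) 1 +
          tpDer (totSign X 1) h (totMap f) 1 ∘ₗ tpD X 1 = LinearMap.id - tpMap f 1 := by
        refine PiTensorProduct.ext (MultilinearMap.ext fun y => ?_)
        simp only [LinearMap.compMultilinearMap_apply, LinearMap.add_apply, LinearMap.sub_apply,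
          LinearMap.comp_apply, LinearMap.id_apply, tpD_tprod, tpDer_tprod,
          Finset.univ_unique, Finset.sum_singleton, tpMap_tprod]
        simp only [hL, Fin.default_eq_zero, lt_self_iff_false, if_false, if_true]
        rw [← map_add, hd, map_sub]
      exact LinearMap.congr_fun e t
    set H := tpDer (totSign X 1) h (totMap f)
    have hH (m : ℕ) : H m ∈ homDeg X m m 1 := tpDer_mem hh (fun _ _ => totMap_mem f) m
    have hf (m : ℕ) (t : TP X m) : tpD X m (tpMap f m t) = tpMap f m (tpD X m t) :=
      (LinearMap.congr_fun (tpMap_tpD f m) t).symm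
    -- With `g` the sign map, the Leibniz rule acquires the Koszul sign for a map of degree one
    -- passing `u`.
    have hJ {a : ℤ} {u : TP X n} (hu : u ∈ tpDeg X n a) (v : TP X 1) :
        H (n + 1) (tpJoin X rfl u v) = tpJoin X rfl (H n u) (tpMap f 1 v) +
          sg K a.negOnePow • tpJoin X rfl u (H 1 v) := by
      rw [tpDer_tpJoin]
      change _ + tpJoin X rfl (tpSign X n 1 u) _ = _
      rw [tpSign_of_mem 1 hu, mul_one, tpJoin_smul_left]
      rfl
    have e : tpD X (n + 1) ∘ₗ H (n + 1) + H (n + 1) ∘ₗ tpD X (n + 1) =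
        LinearMap.id - tpMap f (n + 1) := by
      refine tpJoin_ext (rfl : n + 1 = n + 1) fun a b u v hu hv => ?_
      have hdu := tpD_mem (sub_add_cancel a 1) hu
      have ihu := eq_sub_iff_add_eq.2 (ih u)
      have h1v := eq_sub_iff_add_eq.2 (h1 v)
      simp only [LinearMap.add_apply, LinearMap.sub_apply, LinearMap.comp_apply,
        LinearMap.id_apply]
      -- The mixed terms in `H u ⊗ d v` and `d u ⊗ H v` cancel, and what remains telescopes: `(u - f
      -- u) ⊗ f v + u ⊗ (v - f v) = u ⊗ v - f u ⊗ f v`.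
      rw [hJ hu, map_add, map_smul, tpJoin_tpD_of_mem _ (hH n a _ rfl u hu),
        tpJoin_tpD_of_mem _ hu, tpJoin_tpD_of_mem _ hu, map_add, map_smul, hJ hdu, hJ hu,
        ihu, h1v, tpMap_tpJoin, hf]
      simp only [← tpJoinₗ_apply, map_sub, LinearMap.sub_apply, smul_add, smul_sub, sg_smul_sg,
        ← Int.negOnePow_add, Int.negOnePow_sub, Int.negOnePow_one, mul_neg, mul_one, sg_neg,
        Int.negOnePow_even _ ⟨a, rfl⟩, sg_one, one_smul, Int.negOnePow_add a 1, neg_smul]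
      abel
    exact LinearMap.congr_fun e t

/-! ### Intertwining relations, stable under the structure of endomorphism props -/

/-- The operations `a` on `X` and `b` on `Y` commute with the chain map `f`. -/
def Intertwines (f : X ⟶ Y) {m n : ℕ} {k : ℤ} (a : homDeg X m n k) (b : homDeg Y m n k) : Prop :=
  tpMap f n ∘ₗ a.1 = b.1 ∘ₗ tpMap f m

namespace Intertwines

variable {f : X ⟶ Y}

theorem apply {m n : ℕ} {k : ℤ} {a : homDeg X m n k} {b : homDeg Y m n k}
    (h : Intertwines f a b) (t : TP X m) : tpMap f n (a.1 t) = b.1 (tpMap f m t) :=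
  LinearMap.congr_fun h t

theorem add {m n : ℕ} {k : ℤ} {a a' : homDeg X m n k} {b b' : homDeg Y m n k}
    (h : Intertwines f a b) (h' : Intertwines f a' b') : Intertwines f (a + a') (b + b') := by
  change tpMap f n ∘ₗ (a.1 + a'.1) = (b.1 + b'.1) ∘ₗ tpMap f m
  rw [LinearMap.comp_add, LinearMap.add_comp]
  exact congrArg₂ _ h h'

theorem smul {m n : ℕ} {k : ℤ} {a : homDeg X m n k} {b : homDeg Y m n k} (c : K)
    (h : Intertwines f a b) : Intertwines f (c • a) (c • b) := by
  change tpMap f n ∘ₗ (c • a.1) = (c • b.1) ∘ₗ tpMap f m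
  rw [LinearMap.comp_smul, LinearMap.smul_comp]
  exact congrArg _ h

theorem homD {m n : ℕ} {k l : ℤ} (hl : l + 1 = k) {a : homDeg X m n k} {b : homDeg Y m n k}
    (h : Intertwines f a b) : Intertwines f (homD X m n hl a) (homD Y m n hl b) := by
  refine LinearMap.ext fun t => ?_
  change tpMap f n (tpD X n (a.1 t) - sg K k.negOnePow • a.1 (tpD X m t)) =
    tpD Y n (b.1 (tpMap f m t)) - sg K k.negOnePow • b.1 (tpD Y m (tpMap f m t))
  have e (n : ℕ) (t : TP X n) : tpMap f n (tpD X n t) = tpD Y n (tpMap f n t) :=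
    LinearMap.congr_fun (tpMap_tpD f n) t
  rw [map_sub, map_smul, e, h.apply, h.apply, e]

theorem vcomp {m k n : ℕ} {i j l : ℤ} (hl : i + j = l) {a : homDeg X k n i} {b : homDeg Y k n i}
    {a' : homDeg X m k j} {b' : homDeg Y m k j} (h : Intertwines f a b)
    (h' : Intertwines f a' b') : Intertwines f (homVcomp X hl a a') (homVcomp Y hl b b') := by
  refine LinearMap.ext fun t => ?_
  change tpMap f n (a.1 (a'.1 t)) = b.1 (b'.1 (tpMap f m t))
  rw [h.apply, h'.apply]

theorem hcomp {m₁ m₂ m n₁ n₂ n : ℕ} (hm : m₁ + m₂ = m) (hn : n₁ + n₂ = n) {i j l : ℤ}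
    (hl : i + j = l) {a : homDeg X m₁ n₁ i} {b : homDeg Y m₁ n₁ i} {a' : homDeg X m₂ n₂ j}
    {b' : homDeg Y m₂ n₂ j} (h : Intertwines f a b) (h' : Intertwines f a' b') :
    Intertwines f (homHcomp X hm hn hl a a') (homHcomp Y hm hn hl b b') := by
  refine tpJoin_ext hm fun p q u v hu hv => ?_
  change tpMap f n (homTensor X hm hn j a.1 a'.1 (tpJoin X hm u v)) =
    homTensor Y hm hn j b.1 b'.1 (tpMap f m (tpJoin X hm u v))
  rw [homTensor_tpJoin hm hn _ _ hu, map_smul, tpMap_tpJoin, tpMap_tpJoin,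
    homTensor_tpJoin hm hn _ _ (tpMap_mem f hu), h.apply, h'.apply]

theorem perm {n : ℕ} (σ : Equiv.Perm (Fin n)) : Intertwines f (homPerm X σ) (homPerm Y σ) :=
  tpMap_tpPerm f σ

end Intertwines
end Intertwining
-- The natural contraction of the twisted sum
section TwistedSum
variable {K : Type u} [Field K] {X Y X' Y' : Ch K}

theorem Intertwines.sub {f : X ⟶ Y} {m n : ℕ} {k : ℤ} {a a' : homDeg X m n k}
    {b b' : homDeg Y m n k} (h : Intertwines f a b) (h' : Intertwines f a' b') :
    Intertwines f (a - a') (b - b') := by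
  change tpMap f n ∘ₗ (a.1 - a'.1) = (b.1 - b'.1) ∘ₗ tpMap f m
  rw [LinearMap.comp_sub, LinearMap.sub_comp]
  exact congrArg₂ _ h h'

/-- Two operations over the same `b` differ by one that `f` annihilates. This is how subtracting the
chosen lift of an operation moves a family into the kernel. -/
theorem Intertwines.sub_right {f : X ⟶ Y} {m n : ℕ} {k : ℤ} {a a' : homDeg X m n k}
    {b : homDeg Y m n k} (h : Intertwines f a b) (h' : Intertwines f a' b) :
    Intertwines f (a - a') 0 := by
  have e : (b - b : homDeg Y m n k) = 0 := Subtype.ext (sub_self b.1)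
  exact e ▸ h.sub h'

theorem Intertwines.zero (f : X ⟶ Y) (m n : ℕ) (k : ℤ) :
    Intertwines f (0 : homDeg X m n k) (0 : homDeg Y m n k) := by
  change tpMap f n ∘ₗ (0 : TP X m →ₗ[K] TP X n) = (0 : TP Y m →ₗ[K] TP Y n) ∘ₗ tpMap f m
  rw [LinearMap.comp_zero, LinearMap.zero_comp]

/-- The contracting homotopy `(x, y', y) ↦ (0, 0, -y')` of the kernel of `s : Z ⟶ X`, on a
component. -/
noncomputable def twHX (f : X ⟶ Y) (i : ℤ) : (tw f).X i →ₗ[K] (tw f).X (i + 1) :=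
  show (X.X i × Y.X (i + 1) × Y.X i) →ₗ[K] (X.X (i + 1) × Y.X (i + 1 + 1) × Y.X (i + 1)) from
    LinearMap.inr K _ _ ∘ₗ LinearMap.inr K _ _ ∘ₗ (-LinearMap.id) ∘ₗ LinearMap.fst K _ _ ∘ₗ
      LinearMap.snd K _ _

/-- The section `y ↦ (0, 0, y)` of a component of `p : Z ⟶ Y`. -/
noncomputable def twSecX (f : X ⟶ Y) (i : ℤ) : Y.X i →ₗ[K] (tw f).X i :=
  show Y.X i →ₗ[K] (X.X i × Y.X (i + 1) × Y.X i) from LinearMap.inr K _ _ ∘ₗ LinearMap.inr K _ _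

/-- The contracting homotopy `(x, y', y) ↦ (0, 0, -y')` of the kernel of `s : Z ⟶ X`. -/
noncomputable def twH (f : X ⟶ Y) : Tot (tw f) →ₗ[K] Tot (tw f) :=
  totDesc (tw f) fun i => tin (tw f) (i + 1) ∘ₗ twHX f i

/-- The graded section `y ↦ (0, 0, y)` of `p : Z ⟶ Y`. -/
noncomputable def twSec (f : X ⟶ Y) : Tot Y →ₗ[K] Tot (tw f) :=
  totDesc Y fun i => tin (tw f) i ∘ₗ twSecX f i

theorem twH_tin (f : X ⟶ Y) (i : ℤ) (z : (tw f).X i) :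
    twH f (tin (tw f) i z) = tin (tw f) (i + 1) (twHX f i z) :=
  totDesc_tin _ _ _

theorem twSec_tin (f : X ⟶ Y) (i : ℤ) (y : Y.X i) :
    twSec f (tin Y i y) = tin (tw f) i (twSecX f i y) :=
  totDesc_tin _ _ _

theorem twH_mem (f : X ⟶ Y) (i : ℤ) (z : Tot (tw f)) (hz : z ∈ totDeg (tw f) i) :
    twH f z ∈ totDeg (tw f) (i + 1) := by
  obtain ⟨z, rfl⟩ := hz
  exact ⟨_, (twH_tin f i z).symm⟩

theorem twSec_mem (f : X ⟶ Y) (i : ℤ) (y : Tot Y) (hy : y ∈ totDeg Y i) :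
    twSec f y ∈ totDeg (tw f) i := by
  obtain ⟨y, rfl⟩ := hy
  exact ⟨_, (twSec_tin f i y).symm⟩

/-- On `(x, y', y)`, `d h` gives `(0, y', -d y')` and `h d` gives `(0, 0, -f x + d y' + y)`, with
sum `(0, y', y - f x)`. -/
theorem totD_twH_add (f : X ⟶ Y) (z : Tot (tw f)) :
    totD (tw f) (twH f z) + twH f (totD (tw f) z) = z - totMap (twFst f ≫ twIncl f) z := by
  have : totD (tw f) ∘ₗ twH f + twH f ∘ₗ totD (tw f) =
      LinearMap.id - totMap (twFst f ≫ twIncl f) := by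
    refine tot_ext fun i z => ?_
    -- Writing the degree as a successor makes the degree transports in `twD` definitionally
    -- trivial.
    obtain ⟨j, rfl⟩ : ∃ j, i = j + 1 := ⟨i - 1, by omega⟩
    simp only [LinearMap.add_apply, LinearMap.sub_apply, LinearMap.comp_apply, LinearMap.id_apply]
    rw [twH_tin, totD_tin _ (j + 1) rfl, totD_tin _ j rfl, twH_tin, totMap_tin, ← map_add,
      ← map_sub, tw_d f rfl, tw_d f rfl]
    refine congrArg _ (Prod.ext ?_ (Prod.ext ?_ ?_))
    · change (X.d (j + 1 + 1) (j + 1)).hom 0 + 0 = z.1 - z.1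
      rw [map_zero, add_zero, sub_self]
    · change (f.f (j + 1 + 1)).hom 0 - (Y.d (j + 1 + 1 + 1) (j + 1 + 1)).hom 0 - -z.2.1 + 0 =
        z.2.1 - 0
      simp
    · change (Y.d (j + 1 + 1) (j + 1)).hom (-z.2.1) + -((f.f (j + 1)).hom z.1 -
        (Y.d (j + 1 + 1) (j + 1)).hom z.2.1 - z.2.2) = z.2.2 - (f.f (j + 1)).hom z.1
      rw [map_neg]
      abel
  exact LinearMap.congr_fun this z

/-- The homotopy sees only the middle coordinate, which is zero on the image of `i`. Hence
precomposition with the homotopy creates operations that restrict to zero along `i`. -/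
theorem twH_comp_twIncl (f : X ⟶ Y) : twH f ∘ₗ totMap (twIncl f) = 0 := by
  refine tot_ext fun i x => ?_
  rw [LinearMap.comp_apply, totMap_tin, twH_tin, LinearMap.zero_apply]
  refine (congrArg _ ?_).trans (map_zero (tin (tw f) (i + 1)))
  exact Prod.ext rfl (Prod.ext rfl neg_zero)

theorem twProj_comp_twSec (f : X ⟶ Y) : totMap (twProj f) ∘ₗ twSec f = LinearMap.id := by
  refine tot_ext fun i y => ?_
  rw [LinearMap.comp_apply, twSec_tin, totMap_tin]
  rfl

theorem twFst_comp_twSec (f : X ⟶ Y) : totMap (twFst f) ∘ₗ twSec f = 0 := by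
  refine tot_ext fun i y => ?_
  rw [LinearMap.comp_apply, twSec_tin, totMap_tin]
  exact map_zero (tin X i)

variable {f : X ⟶ Y} {f' : X' ⟶ Y'} {α : X ⟶ X'} {β : Y ⟶ Y'} (w : α ≫ f' = f ≫ β)

theorem twMap_comp_twH : totMap (twMap f f' α β w) ∘ₗ twH f =
    twH f' ∘ₗ totMap (twMap f f' α β w) := by
  refine tot_ext fun i z => ?_
  rw [LinearMap.comp_apply, LinearMap.comp_apply, twH_tin, totMap_tin, totMap_tin, twH_tin]
  exact congrArg _ (Prod.ext (map_zero (α.f _).hom) (Prod.ext (map_zero (β.f _).hom)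
    (map_neg (β.f _).hom _)))

theorem twMap_comp_twSec : totMap (twMap f f' α β w) ∘ₗ twSec f = twSec f' ∘ₗ totMap β := by
  refine tot_ext fun i z => ?_
  rw [LinearMap.comp_apply, LinearMap.comp_apply, twSec_tin, totMap_tin, totMap_tin, twSec_tin]
  exact congrArg _ (Prod.ext (map_zero (α.f _).hom) (Prod.ext (map_zero (β.f _).hom) rfl))

variable (f) in
/-- The homotopy from `(i s)^{⊗ n}` to the identity of `Z^{⊗ n}`. -/
noncomputable def twHomotopy (n : ℕ) : homDeg (tw f) n n 1 :=
  ⟨tpDer (totSign (tw f) 1) (twH f) (totMap (twFst f ≫ twIncl f)) n,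
    tpDer_mem (twH_mem f) (fun _ _ => totMap_mem _) n⟩

theorem homD_twHomotopy_apply {n : ℕ} (t : TP (tw f) n) :
    (homD (tw f) n n (zero_add 1) (twHomotopy f n)).1 t =
      t - tpMap (twIncl f) n (tpMap (twFst f) n t) := by
  change tpD (tw f) n ((twHomotopy f n).1 t) -
    sg K (1 : ℤ).negOnePow • (twHomotopy f n).1 (tpD (tw f) n t) = _
  -- The homotopy has odd degree, so its differential in the internal hom is the anticommutator `d H
  -- + H d`.
  rw [Int.negOnePow_one, sg_neg, sg_one, neg_one_smul, sub_neg_eq_add]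
  refine (tpD_tpDer_add (twH_mem f) (totD_twH_add f) t).trans ?_
  rw [tpMap_comp, LinearMap.comp_apply]

theorem twHomotopy_twIncl {n : ℕ} (t : TP X n) :
    (twHomotopy f n).1 (tpMap (twIncl f) n t) = 0 :=
  LinearMap.congr_fun (tpDer_comp_map_eq_zero (twH_comp_twIncl f) n) t

theorem intertwines_twHomotopy (n : ℕ) :
    Intertwines (twMap f f' α β w) (twHomotopy f n) (twHomotopy f' n) := by
  refine map_comp_tpDer (totMap_totSign _ 1) (twMap_comp_twH w) ?_ n
  -- The remaining goal is the naturality of `i s`, which follows from the commutative square.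
  rw [← totMap_comp, ← totMap_comp]
  refine congrArg _ (HomologicalComplex.hom_ext _ _ fun k => ModuleCat.hom_ext
    (LinearMap.ext fun z => Prod.ext rfl (Prod.ext (map_zero (β.f (k + 1)).hom) ?_)))
  exact congrArg (fun h : X ⟶ Y' => (h.f k).hom z.1) w.symm

/-- Precomposition with the homotopy. -/
noncomputable def twContract (f : X ⟶ Y) {m n : ℕ} {k : ℤ} (x : homDeg (tw f) m n k) :
    homDeg (tw f) m n (k + 1) :=
  homVcomp (tw f) rfl x (twHomotopy f m)

/-- No assumption on `x` is needed, because the homotopy already vanishes on the image of `i`. -/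
theorem intertwines_twIncl_twContract {m n : ℕ} {k : ℤ} (x : homDeg (tw f) m n k) :
    Intertwines (twIncl f) 0 (twContract f x) := by
  refine LinearMap.ext fun t => ?_
  change tpMap (twIncl f) n 0 = x.1 ((twHomotopy f m).1 (tpMap (twIncl f) m t))
  rw [twHomotopy_twIncl, map_zero, map_zero]

/-- The contraction acts at the inputs, so it preserves relations that concern only the outputs. It
is applied to `p` and to `s`. -/
theorem intertwines_twContract_zero {W : Ch K} {g : tw f ⟶ W} {m n : ℕ} {k : ℤ}
    {x : homDeg (tw f) m n k} (hx : Intertwines g x 0) : Intertwines g (twContract f x) 0 :=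
  LinearMap.ext fun t => hx.apply ((twHomotopy f m).1 t)

theorem intertwines_twContract {m n : ℕ} {k : ℤ} {x : homDeg (tw f) m n k}
    {x' : homDeg (tw f') m n k} (hx : Intertwines (twMap f f' α β w) x x') :
    Intertwines (twMap f f' α β w) (twContract f x) (twContract f' x') :=
  hx.vcomp rfl (intertwines_twHomotopy w m)

/-- By the Leibniz rule only `± x ∘ d H = ± x ∘ (1 - i s)` survives, and `x` vanishes on the image
of `i`. This is the acyclicity of the kernel, one arrow at a time. -/
theorem homD_twContract {m n : ℕ} {k l : ℤ} (hl : l + 1 = k) {x : homDeg (tw f) m n k}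
    (hx : Intertwines (twIncl f) 0 x) (hd : homD (tw f) m n hl x = 0) :
    homD (tw f) m n rfl (twContract f x) = sg K k.negOnePow • x := by
  rw [twContract, homD_vcomp (tw f) rfl hl (zero_add 1) rfl (by omega) (add_zero k), hd,
    map_zero, LinearMap.zero_apply, zero_add]
  refine congrArg _ (Subtype.ext (LinearMap.ext fun t => ?_))
  change x.1 ((homD (tw f) m m (zero_add 1) (twHomotopy f m)).1 t) = x.1 t
  rw [homD_twHomotopy_apply, map_sub, ← hx.apply]
  change x.1 t - tpMap (twIncl f) n 0 = x.1 t
  rw [map_zero, sub_zero]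

/-! ### Lifting operations to the twisted sum -/

/-- The operation on `Z` determined by an operation on `X` and one on `Y`. -/
noncomputable def twOp (f : X ⟶ Y) {m n : ℕ} {k : ℤ} (a : homDeg X m n k) (b : homDeg Y m n k) :
    homDeg (tw f) m n k :=
  -- The first summand prescribes the values on the image of `i`. The second vanishes there and
  -- corrects the image under `p`; since `twSec f` is only a graded map, the result need not be
  -- compatible with differentials.
  ⟨tpMap (twIncl f) n ∘ₗ a.1 ∘ₗ tpMap (twFst f) m +
    (PiTensorProduct.map fun _ => twSec f) ∘ₗ b.1 ∘ₗ tpMap (twProj f) m ∘ₗ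
      (LinearMap.id - tpMap (twIncl f) m ∘ₗ tpMap (twFst f) m), by
    intro p q h t ht
    refine Submodule.add_mem _ (tpMap_mem _ (a.2 p q h _ (tpMap_mem _ ht)))
      (tprod_map_mem _ (twSec_mem f) (b.2 p q h _ (tpMap_mem _ (Submodule.sub_mem _ ht ?_))))
    exact tpMap_mem _ (tpMap_mem _ ht)⟩

theorem twOp_apply {m n : ℕ} {k : ℤ} (a : homDeg X m n k) (b : homDeg Y m n k)
    (t : TP (tw f) m) :
    (twOp f a b).1 t = tpMap (twIncl f) n (a.1 (tpMap (twFst f) m t)) +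
      PiTensorProduct.map (fun _ => twSec f) (b.1 (tpMap (twProj f) m
        (t - tpMap (twIncl f) m (tpMap (twFst f) m t)))) := rfl

theorem tpMap_twFst_twIncl {n : ℕ} (t : TP X n) :
    tpMap (twFst f) n (tpMap (twIncl f) n t) = t := by
  rw [← LinearMap.comp_apply, ← tpMap_comp]
  exact LinearMap.congr_fun (tpMap_id X n) t

theorem tpMap_twProj_twIncl {n : ℕ} (t : TP X n) :
    tpMap (twProj f) n (tpMap (twIncl f) n t) = tpMap f n t := by
  rw [← LinearMap.comp_apply, ← tpMap_comp]
  rfl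

theorem tpMap_twProj_twSec {n : ℕ} (t : TP Y n) :
    tpMap (twProj f) n (PiTensorProduct.map (fun _ => twSec f) t) = t := by
  rw [← LinearMap.comp_apply, tpMap, ← PiTensorProduct.map_comp]
  simp only [twProj_comp_twSec, PiTensorProduct.map_id, LinearMap.id_apply]

/-- At least one factor is needed for `s σ = 0` to take effect: the zeroth tensor power of any map
is an identity. This is the source of the restriction on operations without outputs. -/
theorem tpMap_twFst_twSec {n : ℕ} (hn : n ≠ 0) (t : TP Y n) :
    tpMap (twFst f) n (PiTensorProduct.map (fun _ => twSec f) t) = 0 := by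
  rw [← LinearMap.comp_apply, tpMap, ← PiTensorProduct.map_comp]
  simp only [twFst_comp_twSec]
  have : PiTensorProduct.map (R := K) (fun _ : Fin n => (0 : Tot Y →ₗ[K] Tot X)) = 0 := by
    refine PiTensorProduct.ext (MultilinearMap.ext fun y => ?_)
    rw [LinearMap.compMultilinearMap_apply, PiTensorProduct.map_tprod]
    exact MultilinearMap.map_coord_zero _ (⟨0, Nat.pos_of_ne_zero hn⟩ : Fin n) rfl
  rw [this, LinearMap.zero_apply]

theorem tpMap_zero (g : X ⟶ Y) (g' : Y ⟶ X) (t : TP X 0) : tpMap g' 0 (tpMap g 0 t) = t := by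
  rw [← LinearMap.comp_apply, ← tpMap_comp]
  have : tpMap (g ≫ g') 0 = LinearMap.id := by
    refine PiTensorProduct.ext (MultilinearMap.ext fun y => ?_)
    rw [LinearMap.compMultilinearMap_apply, tpMap_tprod]
    exact congrArg _ (Subsingleton.elim _ _)
  rw [this, LinearMap.id_apply]

section Op
variable {m n : ℕ} {k : ℤ} {a : homDeg X m n k} {b : homDeg Y m n k}

theorem intertwines_twIncl_twOp : Intertwines (twIncl f) a (twOp f a b) := by
  refine LinearMap.ext fun t => ?_
  rw [LinearMap.comp_apply, LinearMap.comp_apply, twOp_apply, tpMap_twFst_twIncl, sub_self,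
    map_zero, map_zero, map_zero, add_zero]

/-- Since `p i = f` and `p σ = 1`, the composite with `p` is `f a s + b p - b f s`, and `f a = b f`.
-/
theorem intertwines_twProj_twOp (h : Intertwines f a b) :
    Intertwines (twProj f) (twOp f a b) b := by
  refine LinearMap.ext fun t => ?_
  rw [LinearMap.comp_apply, LinearMap.comp_apply, twOp_apply, map_add, tpMap_twProj_twIncl,
    tpMap_twProj_twSec, map_sub, tpMap_twProj_twIncl, map_sub, h.apply, add_sub_cancel]

theorem intertwines_twFst_twOp_of_ne_zero (hn : n ≠ 0) :
    Intertwines (twFst f) (twOp f a b) a := by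
  refine LinearMap.ext fun t => ?_
  rw [LinearMap.comp_apply, LinearMap.comp_apply, twOp_apply, map_add, tpMap_twFst_twIncl,
    tpMap_twFst_twSec hn, add_zero]

/-- On the zeroth tensor power `i s` is the identity, so the correction term vanishes even when
there are no outputs. -/
theorem intertwines_twFst_twOp_of_inputs_eq_zero {a : homDeg X 0 n k} {b : homDeg Y 0 n k} :
    Intertwines (twFst f) (twOp f a b) a := by
  refine LinearMap.ext fun t => ?_
  rw [LinearMap.comp_apply, LinearMap.comp_apply, twOp_apply, tpMap_zero, sub_self,
    map_zero, map_zero, map_zero, add_zero, tpMap_twFst_twIncl]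

theorem twOp_zero : twOp f (0 : homDeg X m n k) 0 = 0 := by
  refine Subtype.ext (LinearMap.ext fun t => ?_)
  rw [twOp_apply]
  change tpMap (twIncl f) n 0 + PiTensorProduct.map (fun _ => twSec f) 0 = 0
  rw [map_zero, map_zero, add_zero]

/-- All four ingredients `i`, `s`, `p` and `σ` of the lift are natural in the arrow. -/
theorem intertwines_twOp {a' : homDeg X' m n k} {b' : homDeg Y' m n k}
    (ha : Intertwines α a a') (hb : Intertwines β b b') :
    Intertwines (twMap f f' α β w) (twOp f a b) (twOp f' a' b') := by
  have hi (n : ℕ) (t : TP X n) : tpMap (twMap f f' α β w) n (tpMap (twIncl f) n t) =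
      tpMap (twIncl f') n (tpMap α n t) := by
    rw [← LinearMap.comp_apply, ← LinearMap.comp_apply, ← tpMap_comp, ← tpMap_comp]
    congr 2
    refine HomologicalComplex.hom_ext _ _ fun k => ModuleCat.hom_ext (LinearMap.ext fun x =>
      Prod.ext rfl (Prod.ext (map_zero (β.f (k + 1)).hom) ?_))
    exact congrArg (fun h : X ⟶ Y' => (h.f k).hom x) w.symm
  have hs (t : TP (tw f) m) : tpMap (twFst f') m (tpMap (twMap f f' α β w) m t) =
      tpMap α m (tpMap (twFst f) m t) := by
    rw [← LinearMap.comp_apply, ← LinearMap.comp_apply, ← tpMap_comp, ← tpMap_comp]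
    rfl
  have hp (t : TP (tw f) m) : tpMap (twProj f') m (tpMap (twMap f f' α β w) m t) =
      tpMap β m (tpMap (twProj f) m t) := by
    rw [← LinearMap.comp_apply, ← LinearMap.comp_apply, ← tpMap_comp, ← tpMap_comp]
    rfl
  have hσ (t : TP Y n) :
      tpMap (twMap f f' α β w) n (PiTensorProduct.map (fun _ => twSec f) t) =
        PiTensorProduct.map (fun _ => twSec f') (tpMap β n t) := by
    rw [← LinearMap.comp_apply, ← LinearMap.comp_apply, tpMap, tpMap,
      ← PiTensorProduct.map_comp, ← PiTensorProduct.map_comp]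
    simp only [twMap_comp_twSec]
  refine LinearMap.ext fun t => ?_
  rw [LinearMap.comp_apply, LinearMap.comp_apply, twOp_apply, twOp_apply, map_add, hi, ha.apply,
    hs, hσ, hb.apply, ← hp, map_sub (tpMap (twMap f f' α β w) m), hi]

end Op

end TwistedSum
-- Small subprops of large products of dg props
section SubProp
universe v
variable {K : Type u} [Field K] {J : Type v} (D : J → DGProp K)

/-- The families of operations of arity `(m, n)` and degree `k` of the dg props `D j`. -/
abbrev OpFamily (m n : ℕ) (k : ℤ) : Type (max u v) := ∀ j, ((D j).op m n).X k

/-- A family of small submodules of the products `∏ⱼ D j (m, n)` that is closed under the structure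
of a dg prop. The index set `J` may be large. -/
structure SmallSubProp where
  /-- the submodules -/
  S (m n : ℕ) (k : ℤ) : Submodule K (OpFamily D m n k)
  small (m n : ℕ) (k : ℤ) : Small.{u} (S m n k)
  d_mem {m n : ℕ} (k l : ℤ) {x : OpFamily D m n k} (hx : x ∈ S m n k) :
    (fun j => (((D j).op m n).d k l).hom (x j)) ∈ S m n l
  vcomp_mem {m k n : ℕ} {i j l : ℤ} (h : i + j = l) {x : OpFamily D k n i}
    {y : OpFamily D m k j} (hx : x ∈ S k n i) (hy : y ∈ S m k j) :
    (fun a => (D a).vcomp h (x a) (y a)) ∈ S m n l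
  hcomp_mem {m₁ m₂ m n₁ n₂ n : ℕ} (hm : m₁ + m₂ = m) (hn : n₁ + n₂ = n) {i j l : ℤ}
    (h : i + j = l) {x : OpFamily D m₁ n₁ i} {y : OpFamily D m₂ n₂ j} (hx : x ∈ S m₁ n₁ i)
    (hy : y ∈ S m₂ n₂ j) : (fun a => (D a).hcomp hm hn h (x a) (y a)) ∈ S m n l
  perm_mem {n : ℕ} (σ : Equiv.Perm (Fin n)) : (fun a => (D a).perm σ) ∈ S n n 0

namespace SmallSubProp

attribute [instance] SmallSubProp.small

variable {D} (R : SmallSubProp D)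

/-- The complex of elements of arity `(m, n)`, moved to the universe of `K`. -/
noncomputable def complex (m n : ℕ) : Ch K where
  X k := ModuleCat.of K (Shrink.{u} (R.S m n k))
  d k l := ModuleCat.ofHom ((Shrink.linearEquiv K (R.S m n l)).symm.toLinearMap ∘ₗ
    (LinearMap.pi fun a => (((D a).op m n).d k l).hom ∘ₗ LinearMap.proj a).restrict
      (fun _ hx => R.d_mem k l hx) ∘ₗ (Shrink.linearEquiv K (R.S m n k)).toLinearMap)
  shape k l h := by
    refine ModuleCat.hom_ext (LinearMap.ext fun x => ?_)
    refine (congrArg _ (Subtype.ext (funext fun a => ?_))).trans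
      (map_zero (Shrink.linearEquiv K (R.S m n l)).symm)
    change (((D a).op m n).d k l).hom _ = 0
    rw [((D a).op m n).shape k l h]
    rfl
  d_comp_d' i j k _ _ := by
    refine ModuleCat.hom_ext (LinearMap.ext fun x => ?_)
    refine (congrArg _ (Subtype.ext (funext fun a => ?_))).trans
      (map_zero (Shrink.linearEquiv K (R.S m n k)).symm)
    change (((D a).op m n).d j k).hom ((Shrink.linearEquiv K (R.S m n j)
      ((Shrink.linearEquiv K (R.S m n j)).symm _)).1 a) = 0
    rw [LinearEquiv.apply_symm_apply]
    exact LinearMap.congr_fun (congrArg ModuleCat.Hom.hom (((D a).op m n).d_comp_d i j k)) _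

/-- The elements of arity `(m, n)` and degree `k`. -/
abbrev El (m n : ℕ) (k : ℤ) : Type u := (R.complex m n).X k

/-- The identification of the elements with families of operations. -/
noncomputable def elEquiv (m n : ℕ) (k : ℤ) : R.El m n k ≃ₗ[K] R.S m n k :=
  Shrink.linearEquiv K (R.S m n k)

/-- The components of an element. -/
noncomputable def ev (a : J) {m n : ℕ} {k : ℤ} : R.El m n k →ₗ[K] ((D a).op m n).X k :=
  LinearMap.proj a ∘ₗ (R.S m n k).subtype ∘ₗ (R.elEquiv m n k).toLinearMap

/-- The element with given components. -/
noncomputable def ofMem {m n : ℕ} {k : ℤ} (x : OpFamily D m n k) (hx : x ∈ R.S m n k) :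
    R.El m n k :=
  (R.elEquiv m n k).symm ⟨x, hx⟩

variable {R}

theorem ev_ofMem (a : J) {m n : ℕ} {k : ℤ} (x : OpFamily D m n k) (hx : x ∈ R.S m n k) :
    R.ev a (R.ofMem x hx) = x a := by
  simp only [ev, ofMem, LinearMap.comp_apply, LinearEquiv.coe_coe, LinearEquiv.apply_symm_apply]
  rfl

theorem ev_mem {m n : ℕ} {k : ℤ} (x : R.El m n k) : (fun a => R.ev a x) ∈ R.S m n k :=
  (R.elEquiv m n k x).2

/-- Each axiom of a dg prop is verified one component at a time through this lemma. -/
theorem ev_ext {m n : ℕ} {k : ℤ} {x y : R.El m n k} (h : ∀ a, R.ev a x = R.ev a y) : x = y :=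
  (R.elEquiv m n k).injective (Subtype.ext (funext h))

variable (R)

theorem ev_d (a : J) {m n : ℕ} (k l : ℤ) (x : R.El m n k) :
    R.ev a (((R.complex m n).d k l).hom x) = (((D a).op m n).d k l).hom (R.ev a x) :=
  ev_ofMem a (fun a => (((D a).op m n).d k l).hom (R.ev a x)) (R.d_mem k l (ev_mem x))

/-- The vertical composition product. -/
noncomputable def vcompEl {m k n : ℕ} {i j l : ℤ} (h : i + j = l) :
    R.El k n i →ₗ[K] R.El m k j →ₗ[K] R.El m n l :=
  LinearMap.mk₂ K (fun x y => R.ofMem _ (R.vcomp_mem h (ev_mem x) (ev_mem y)))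
    (fun _ _ _ => ev_ext fun a => by simp only [map_add, ev_ofMem, LinearMap.add_apply])
    (fun _ _ _ => ev_ext fun a => by simp only [map_smul, ev_ofMem, LinearMap.smul_apply])
    (fun _ _ _ => ev_ext fun a => by simp only [map_add, ev_ofMem])
    (fun _ _ _ => ev_ext fun a => by simp only [map_smul, ev_ofMem])

theorem ev_vcompEl (a : J) {m k n : ℕ} {i j l : ℤ} (h : i + j = l) (x : R.El k n i)
    (y : R.El m k j) : R.ev a (R.vcompEl h x y) = (D a).vcomp h (R.ev a x) (R.ev a y) :=
  ev_ofMem _ _ _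

/-- The horizontal composition product. -/
noncomputable def hcompEl {m₁ m₂ m n₁ n₂ n : ℕ} (hm : m₁ + m₂ = m) (hn : n₁ + n₂ = n)
    {i j l : ℤ} (h : i + j = l) : R.El m₁ n₁ i →ₗ[K] R.El m₂ n₂ j →ₗ[K] R.El m n l :=
  LinearMap.mk₂ K (fun x y => R.ofMem _ (R.hcomp_mem hm hn h (ev_mem x) (ev_mem y)))
    (fun _ _ _ => ev_ext fun a => by simp only [map_add, ev_ofMem, LinearMap.add_apply])
    (fun _ _ _ => ev_ext fun a => by simp only [map_smul, ev_ofMem, LinearMap.smul_apply])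
    (fun _ _ _ => ev_ext fun a => by simp only [map_add, ev_ofMem])
    (fun _ _ _ => ev_ext fun a => by simp only [map_smul, ev_ofMem])

theorem ev_hcompEl (a : J) {m₁ m₂ m n₁ n₂ n : ℕ} (hm : m₁ + m₂ = m) (hn : n₁ + n₂ = n)
    {i j l : ℤ} (h : i + j = l) (x : R.El m₁ n₁ i) (y : R.El m₂ n₂ j) :
    R.ev a (R.hcompEl hm hn h x y) = (D a).hcomp hm hn h (R.ev a x) (R.ev a y) :=
  ev_ofMem _ _ _

/-- The operations given by permutations. -/
noncomputable def permEl {n : ℕ} (σ : Equiv.Perm (Fin n)) : R.El n n 0 := R.ofMem _ (R.perm_mem σ)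

theorem ev_permEl (a : J) {n : ℕ} (σ : Equiv.Perm (Fin n)) :
    R.ev a (R.permEl σ) = (D a).perm σ := ev_ofMem _ _ _

/-- The dg prop of the elements of a small subprop of a product. -/
noncomputable def toDGProp : DGProp K where
  op := R.complex
  vcomp := R.vcompEl
  hcomp := R.hcompEl
  perm := R.permEl
  d_vcomp h hi hj hl f g := ev_ext fun a => by
    simp only [map_add, map_smul, ev_d, ev_vcompEl]
    exact (D a).d_vcomp h hi hj hl _ _
  d_hcomp hm hn _ _ _ _ _ _ h hi hj hl f g := ev_ext fun a => by
    simp only [map_add, map_smul, ev_d, ev_hcompEl]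
    exact (D a).d_hcomp hm hn h hi hj hl _ _
  d_perm l σ := ev_ext fun a => by
    rw [ev_d, ev_permEl, (D a).d_perm, map_zero]
  vcomp_assoc hij hjk h h' f₁ f₂ f₃ := ev_ext fun a => by
    simp only [ev_vcompEl]
    exact (D a).vcomp_assoc hij hjk h h' _ _ _
  hcomp_assoc h1 h2 h3 h4 h5 h6 h7 h8 _ _ _ _ _ _ hij hjk h h' f₁ f₂ f₃ := ev_ext fun a => by
    simp only [ev_hcompEl]
    exact (D a).hcomp_assoc h1 h2 h3 h4 h5 h6 h7 h8 hij hjk h h' _ _ _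
  exchange hm hk hn _ _ _ _ _ _ _ _ _ hi hj he₁ he₂ h h' f₁ f₂ g₁ g₂ := ev_ext fun a => by
    simp only [map_smul, ev_vcompEl, ev_hcompEl]
    exact (D a).exchange hm hk hn hi hj he₁ he₂ h h' _ _ _ _
  one_vcomp f := ev_ext fun a => by
    rw [ev_vcompEl, ev_permEl]
    exact (D a).one_vcomp _
  vcomp_one f := ev_ext fun a => by
    rw [ev_vcompEl, ev_permEl]
    exact (D a).vcomp_one _
  one_hcomp f := ev_ext fun a => by
    rw [ev_hcompEl, ev_permEl]
    exact (D a).one_hcomp _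
  hcomp_one f := ev_ext fun a => by
    rw [ev_hcompEl, ev_permEl]
    exact (D a).hcomp_one _
  perm_mul σ τ := ev_ext fun a => by
    simp only [ev_vcompEl, ev_permEl]
    exact (D a).perm_mul σ τ
  hcomp_perm hn σ τ := ev_ext fun a => by
    simp only [ev_hcompEl, ev_permEl]
    exact (D a).hcomp_perm hn σ τ
  hcomp_swap hm hm' hn hn' _ _ _ h h' f g := ev_ext fun a => by
    simp only [map_smul, ev_vcompEl, ev_hcompEl, ev_permEl]
    exact (D a).hcomp_swap hm hm' hn hn' h h' _ _

/-- The projections are morphisms of dg props. -/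
noncomputable def proj (a : J) : R.toDGProp ⟶ D a :=
  DGProp.Hom.mk (P := R.toDGProp) (Q := D a)
    (fun m n =>
      { f := fun k => ModuleCat.ofHom (R.ev a)
        comm' := fun k l _ => ModuleCat.hom_ext (LinearMap.ext fun x => (R.ev_d a k l x).symm) })
    (fun h f g => R.ev_vcompEl a h f g)
    (fun hm hn _ _ _ h f g => R.ev_hcompEl a hm hn h f g)
    (fun σ => R.ev_permEl a σ)

end SmallSubProp

/-! ### The subprop generated by operations and a unary operator -/

section Closure

/-- Formal expressions in generators `G`, the operations of dg props and a unary operation of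
degree one. -/
inductive Expr (K : Type u) (G : ℕ → ℕ → ℤ → Type u) : ℕ → ℕ → ℤ → Type u
  | gen {m n : ℕ} {k : ℤ} (g : G m n k) : Expr K G m n k
  | zero {m n : ℕ} {k : ℤ} : Expr K G m n k
  | add {m n : ℕ} {k : ℤ} (s t : Expr K G m n k) : Expr K G m n k
  | smul {m n : ℕ} {k : ℤ} (c : K) (s : Expr K G m n k) : Expr K G m n k
  | diff {m n : ℕ} {k : ℤ} (l : ℤ) (s : Expr K G m n k) : Expr K G m n l
  | vcomp {m k n : ℕ} {i j l : ℤ} (h : i + j = l) (s : Expr K G k n i) (t : Expr K G m k j) :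
    Expr K G m n l
  | hcomp {m₁ m₂ m n₁ n₂ n : ℕ} (hm : m₁ + m₂ = m) (hn : n₁ + n₂ = n) {i j l : ℤ}
    (h : i + j = l) (s : Expr K G m₁ n₁ i) (t : Expr K G m₂ n₂ j) : Expr K G m n l
  | perm {n : ℕ} (σ : Equiv.Perm (Fin n)) : Expr K G n n 0
  | unary {m n : ℕ} {k : ℤ} (s : Expr K G m n k) : Expr K G m n (k + 1)

variable {D} {G : ℕ → ℕ → ℤ → Type u} (γ : ∀ {m n : ℕ} {k : ℤ}, G m n k → OpFamily D m n k)
  (T : ∀ {m n : ℕ} {k : ℤ}, OpFamily D m n k → OpFamily D m n (k + 1))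

/-- The family of operations denoted by an expression. -/
noncomputable def Expr.eval : ∀ {m n : ℕ} {k : ℤ}, Expr K G m n k → OpFamily D m n k
  | _, _, _, .gen g => γ g
  | _, _, _, .zero => 0
  | _, _, _, .add s t => s.eval + t.eval
  | _, _, _, .smul c s => c • s.eval
  | _, _, _, .diff (k := k) l s => fun a => (((D a).op _ _).d k l).hom (s.eval a)
  | _, _, _, .vcomp h s t => fun a => (D a).vcomp h (s.eval a) (t.eval a)
  | _, _, _, .hcomp hm hn h s t => fun a => (D a).hcomp hm hn h (s.eval a) (t.eval a)
  | _, _, _, .perm σ => fun a => (D a).perm σ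
  | _, _, _, .unary s => T s.eval

/-- The small subprop that is generated by a small set of elements and a unary operation. -/
noncomputable def SmallSubProp.closure : SmallSubProp D where
  S m n k :=
    { carrier := Set.range (Expr.eval γ T)
      add_mem' := by
        rintro _ _ ⟨s, rfl⟩ ⟨t, rfl⟩
        exact ⟨.add s t, rfl⟩
      zero_mem' := ⟨.zero, rfl⟩
      smul_mem' := by
        rintro c _ ⟨s, rfl⟩
        exact ⟨.smul c s, rfl⟩ }
  -- However large `J` is, the expressions form a type in the universe `u` of the generators and of
  -- `K`.
  small _ _ _ := small_range (Expr.eval γ T)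
  d_mem k l := by
    rintro _ ⟨s, rfl⟩
    exact ⟨.diff l s, rfl⟩
  vcomp_mem h := by
    rintro _ _ ⟨s, rfl⟩ ⟨t, rfl⟩
    exact ⟨.vcomp h s t, rfl⟩
  hcomp_mem hm hn _ _ _ h := by
    rintro _ _ ⟨s, rfl⟩ ⟨t, rfl⟩
    exact ⟨.hcomp hm hn h s t, rfl⟩
  perm_mem σ := ⟨.perm σ, rfl⟩

end Closure
end SubProp
section Closure
universe v
variable {K : Type u} [Field K] {J : Type v} {D : J → DGProp K} {G : ℕ → ℕ → ℤ → Type u}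
  {γ : ∀ {m n k}, G m n k → OpFamily D m n k}
  {T : ∀ {m n k}, OpFamily D m n k → OpFamily D m n (k + 1)}

/-- The operation on a chain complex given by a morphism to its endomorphism prop. -/
noncomputable def DGProp.Hom.toEnd {Q : DGProp K} {U : Ch K} (φ : Q ⟶ endProp U) {m n : ℕ} {k : ℤ} :
    (Q.op m n).X k →ₗ[K] homDeg U m n k :=
  ((DGProp.Hom.app φ m n).f k).hom

/-- Expressions allow a differential between any two degrees; this disposes of the nonadjacent ones.
-/
theorem endProp_d_eq_zero (U : Ch K) {m n : ℕ} {k l : ℤ} (h : ¬ l + 1 = k) (a : homDeg U m n k) :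
    (((endProp U).op m n).d k l).hom a = (0 : homDeg U m n l) := by
  have : ((endProp U).op m n).d k l = 0 := dif_neg h
  rw [this]
  rfl

theorem endProp_d (U : Ch K) {m n : ℕ} {k l : ℤ} (h : l + 1 = k) (a : homDeg U m n k) :
    (((endProp U).op m n).d k l).hom a = homD U m n h a := by
  have : ((endProp U).op m n).d k l = ModuleCat.ofHom (homD U m n h) := dif_pos h
  rw [this]
  rfl

theorem DGProp.Hom.toEnd_d {Q : DGProp K} {U : Ch K} (φ : Q ⟶ endProp U) {m n : ℕ} (k l : ℤ)
    (x : (Q.op m n).X k) : DGProp.Hom.toEnd φ (((Q.op m n).d k l).hom x) =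
      (((endProp U).op m n).d k l).hom (DGProp.Hom.toEnd φ x) :=
  hom_comm_apply (DGProp.Hom.app φ m n) k l x

/-- An intertwining relation holds on a subprop if it holds on the generators. -/
theorem intertwines_of_mem_closure {U V : Ch K} (f : U ⟶ V) {a b : J} (φ : D a ⟶ endProp U)
    (ψ : D b ⟶ endProp V)
    (hγ : ∀ {m n k} (g : G m n k),
      Intertwines f (DGProp.Hom.toEnd φ (γ g a)) (DGProp.Hom.toEnd ψ (γ g b)))
    (hT : ∀ {m n k} (x : OpFamily D m n k),
      Intertwines f (DGProp.Hom.toEnd φ (x a)) (DGProp.Hom.toEnd ψ (x b)) →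
      Intertwines f (DGProp.Hom.toEnd φ (T x a)) (DGProp.Hom.toEnd ψ (T x b)))
    {m n : ℕ} {k : ℤ} {x : OpFamily D m n k} (hx : x ∈ (SmallSubProp.closure γ T).S m n k) :
    Intertwines f (DGProp.Hom.toEnd φ (x a)) (DGProp.Hom.toEnd ψ (x b)) := by
  obtain ⟨s, rfl⟩ := hx
  -- The induction is on an expression for `x`. Each prop operation preserves intertwining, so only
  -- the generators and the unary operator call on the hypotheses.
  induction s with
  | gen g => exact hγ g
  | zero =>
    simp only [Expr.eval, Pi.zero_apply, map_zero]
    exact Intertwines.zero f _ _ _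
  | add s t hs ht =>
    simp only [Expr.eval, Pi.add_apply, map_add]
    exact hs.add ht
  | smul c s hs =>
    simp only [Expr.eval, Pi.smul_apply, map_smul]
    exact hs.smul c
  | @diff m n k l s hs =>
    simp only [Expr.eval, DGProp.Hom.toEnd_d]
    by_cases h : l + 1 = k
    · rw [endProp_d U h, endProp_d V h]
      exact hs.homD h
    · rw [endProp_d_eq_zero U h, endProp_d_eq_zero V h]
      exact Intertwines.zero f _ _ _
  | vcomp h s t hs ht =>
    have := hs.vcomp h ht
    exact (DGProp.Hom.map_vcomp φ h (s.eval γ T a) (t.eval γ T a)) ▸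
      (DGProp.Hom.map_vcomp ψ h (s.eval γ T b) (t.eval γ T b)) ▸ this
  | hcomp hm hn h s t hs ht =>
    have := hs.hcomp hm hn h ht
    exact (DGProp.Hom.map_hcomp φ hm hn h (s.eval γ T a) (t.eval γ T a)) ▸
      (DGProp.Hom.map_hcomp ψ hm hn h (s.eval γ T b) (t.eval γ T b)) ▸ this
  | perm σ =>
    have := Intertwines.perm (f := f) σ
    exact (DGProp.Hom.map_perm φ σ) ▸ (DGProp.Hom.map_perm ψ σ) ▸ this
  | unary s hs => exact hT _ hs

end Closure

/-! ### Compatible families of operations on all twisted sums -/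

section Lifting
variable {K : Type u} [Field K] {P : DGProp K}

/-- The action of an operation on an algebra, as a homogeneous map. -/
noncomputable abbrev Alg.actDeg (A : Alg P) {m n : ℕ} {k : ℤ} :
    (P.op m n).X k →ₗ[K] homDeg A.X m n k :=
  DGProp.Hom.toEnd A.str

/-- The chain map underlying an arrow of algebras. -/
abbrev Alg.arrowHom (f : Arrow (Alg P)) : f.left.X ⟶ f.right.X := Alg.Hom.f f.hom

theorem Alg.intertwines {A B : Alg P} (f : A ⟶ B) {m n : ℕ} {k : ℤ} (p : (P.op m n).X k) :
    Intertwines (Alg.Hom.f f) (A.actDeg p) (B.actDeg p) :=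
  Alg.Hom.comm f p

theorem Alg.arrow_w {f g : Arrow (Alg P)} (φ : f ⟶ g) :
    Alg.Hom.f φ.left ≫ Alg.arrowHom g = Alg.arrowHom f ≫ Alg.Hom.f φ.right :=
  congrArg Alg.Hom.f φ.w

variable (P)

/-- The dg prop `P` and the endomorphism props of the twisted sums associated to the morphisms of
`P`-algebras. -/
noncomputable def twProps : Option (Arrow (Alg P)) → DGProp K
  | none => P
  | some f => endProp (tw (Alg.arrowHom f))

variable {P}

/-- The underlying operation of `P`. -/
noncomputable def twBase {m n : ℕ} {k : ℤ} (x : OpFamily (twProps P) m n k) : (P.op m n).X k := x none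

/-- The operation on the twisted sum associated to `f`. -/
noncomputable def twAt {m n : ℕ} {k : ℤ} (f : Arrow (Alg P))
    (x : OpFamily (twProps P) m n k) :
    homDeg (tw (Alg.arrowHom f)) m n k := x (some f)

/-- The operations on the twisted sums determined by an operation of `P`. -/
noncomputable def twLift {m n : ℕ} {k : ℤ} (p : (P.op m n).X k) : OpFamily (twProps P) m n k
  | none => p
  | some f => twOp (Alg.arrowHom f) (f.left.actDeg p) (f.right.actDeg p)

/-- The contracting homotopy of the kernel of the projection of the families to `P`. -/
noncomputable def twUnary {m n : ℕ} {k : ℤ} (x : OpFamily (twProps P) m n k) :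
    OpFamily (twProps P) m n (k + 1)
  | none => (0 : (P.op m n).X (k + 1))
  | some f => twContract (Alg.arrowHom f)
      -- Subtracting the lift of the base component defines the operator on all families, not just
      -- on the kernel. In the generated subprop the difference is annihilated by `p`, and by `s`
      -- when that lifts.
      (twAt f x - twOp (Alg.arrowHom f) (f.left.actDeg (twBase x)) (f.right.actDeg (twBase x)))

variable (P)

/-- The small dg prop of natural operations on twisted sums generated by the operations `twLift`. -/
noncomputable def twSubProp : SmallSubProp (twProps P) :=
  SmallSubProp.closure (G := fun m n k => (P.op m n).X k) twLift twUnary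

variable {P} {m n : ℕ} {k : ℤ}

theorem intertwines_twIncl_of_mem {x : OpFamily (twProps P) m n k} (hx : x ∈ (twSubProp P).S m n k)
    (f : Arrow (Alg P)) :
    Intertwines (twIncl (Alg.arrowHom f)) (f.left.actDeg (twBase x)) (twAt f x) := by
  -- The component in `P` is compared with the one on `Z` by letting it act on the source of `f`.
  refine intertwines_of_mem_closure (a := none) (b := some f) (D := twProps P) _ f.left.str
    (𝟙 (endProp (tw (Alg.arrowHom f)))) (fun p => ?_) (fun x hx => ?_) hx
  · exact intertwines_twIncl_twOp
  · change Intertwines _ (f.left.actDeg 0) (twAt f (twUnary x))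
    rw [map_zero]
    exact intertwines_twIncl_twContract _

theorem intertwines_twProj_of_mem {x : OpFamily (twProps P) m n k} (hx : x ∈ (twSubProp P).S m n k)
    (f : Arrow (Alg P)) :
    Intertwines (twProj (Alg.arrowHom f)) (twAt f x) (f.right.actDeg (twBase x)) := by
  refine intertwines_of_mem_closure (a := some f) (b := none) (D := twProps P) _
    (𝟙 (endProp (tw (Alg.arrowHom f)))) f.right.str (fun p => ?_) (fun x hx => ?_) hx
  · exact intertwines_twProj_twOp (Alg.intertwines f.hom p)
  · change Intertwines _ (twAt f (twUnary x)) (f.right.actDeg 0)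
    rw [map_zero]
    refine intertwines_twContract_zero ?_
    have hx' : Intertwines _ (twAt f x) (f.right.actDeg (twBase x)) := hx
    exact hx'.sub_right (intertwines_twProj_twOp (Alg.intertwines f.hom (twBase x)))

/-- This makes the twisted sum a functor on algebras: both the chosen lifts and the homotopy are
natural, so every generated family is. -/
theorem intertwines_twMap_of_mem {x : OpFamily (twProps P) m n k} (hx : x ∈ (twSubProp P).S m n k)
    {f g : Arrow (Alg P)} (φ : f ⟶ g) :
    Intertwines (twMap _ _ _ _ (Alg.arrow_w φ)) (twAt f x) (twAt g x) := by
  refine intertwines_of_mem_closure (a := some f) (b := some g) (D := twProps P) _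
    (𝟙 (endProp (tw (Alg.arrowHom f)))) (𝟙 (endProp (tw (Alg.arrowHom g))))
    (fun p => ?_) (fun x hx => ?_) hx
  · exact intertwines_twOp _ (Alg.intertwines φ.left p) (Alg.intertwines φ.right p)
  · exact intertwines_twContract _ (Intertwines.sub hx (intertwines_twOp _
      (Alg.intertwines φ.left (twBase x)) (Alg.intertwines φ.right (twBase x))))

/-- With outputs, `s σ = 0` removes the correction term; with neither inputs nor outputs, `1 - i s`
is zero. In the remaining arities the hypothesis makes `p` itself zero. -/
theorem intertwines_twFst_twOp (hP : P.NonemptyOutputs) (f : Arrow (Alg P))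
    (p : (P.op m n).X k) :
    Intertwines (twFst (Alg.arrowHom f))
      (twOp (Alg.arrowHom f) (f.left.actDeg p) (f.right.actDeg p)) (f.left.actDeg p) := by
  by_cases hn : n = 0
  · subst hn
    by_cases hm : m = 0
    · subst hm
      exact intertwines_twFst_twOp_of_inputs_eq_zero
    · have := hP m hm k
      rw [Subsingleton.elim p 0, map_zero, map_zero, twOp_zero]
      exact Intertwines.zero _ _ _ _
  · exact intertwines_twFst_twOp_of_ne_zero hn

theorem intertwines_twFst_of_mem {x : OpFamily (twProps P) m n k} (hx : x ∈ (twSubProp P).S m n k)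
    (hP : P.NonemptyOutputs) (f : Arrow (Alg P)) :
    Intertwines (twFst (Alg.arrowHom f)) (twAt f x) (f.left.actDeg (twBase x)) := by
  refine intertwines_of_mem_closure (a := some f) (b := none) (D := twProps P) _
    (𝟙 (endProp (tw (Alg.arrowHom f)))) f.left.str (fun p => ?_) (fun x hx => ?_) hx
  · exact intertwines_twFst_twOp hP f p
  · change Intertwines _ (twAt f (twUnary x)) (f.left.actDeg 0)
    rw [map_zero]
    refine intertwines_twContract_zero ?_
    have hx' : Intertwines _ (twAt f x) (f.left.actDeg (twBase x)) := hx
    exact hx'.sub_right (intertwines_twFst_twOp hP f (twBase x))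

end Lifting
-- The acyclic fibration onto `P` and the factorization
section Main
variable {K : Type u} [Field K] (P : DGProp K)

/-- Every operation is the image of a generator, and cycles in the kernel are bounded by their
contraction, which stays in the subprop because the subprop is closed under `twUnary`. -/
theorem twProj_mem_acyclicFibrations :
    DGProp.acyclicFibrations K ((twSubProp P).proj none) := by
  intro m n
  have hsurj (k : ℤ) (p : (P.op m n).X k) : ∃ x : (twSubProp P).El m n k,
      (twSubProp P).ev none x = p :=
    ⟨(twSubProp P).ofMem (twLift p) ⟨.gen p, rfl⟩, SmallSubProp.ev_ofMem _ _ _⟩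
  refine ⟨hsurj, quasiIso_of_surjective _ hsurj ?_⟩
  rintro _ _ k rfl rfl (x : (twSubProp P).El m n (k + 1)) hx hd
  replace hx : (twSubProp P).ev none x = 0 := hx
  replace hd : (((twSubProp P).complex m n).d (k + 1) k).hom x = 0 := hd
  set y : OpFamily (twProps P) m n (k + 1) := fun a => (twSubProp P).ev a x
  have hmem : y ∈ (twSubProp P).S m n (k + 1) := SmallSubProp.ev_mem x
  have hT : twUnary y ∈ (twSubProp P).S m n (k + 1 + 1) := by
    obtain ⟨s, hs⟩ := hmem
    exact ⟨.unary s, congrArg twUnary hs⟩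
  have hbase : twBase y = 0 := hx
  -- This cancels the sign in `homD_twContract`, where the cycle has degree `k + 1`.
  let c := sg K (k + 1).negOnePow
  refine ⟨c • (twSubProp P).ofMem (twUnary y) hT, ?_, ?_⟩
  · change (twSubProp P).ev none (c • (twSubProp P).ofMem (twUnary y) hT) = 0
    rw [map_smul, SmallSubProp.ev_ofMem]
    exact smul_zero (A := (P.op m n).X (k + 1 + 1)) c
  · refine SmallSubProp.ev_ext fun a => ?_
    refine ((twSubProp P).ev_d a (k + 1 + 1) (k + 1) _).trans ?_
    rw [map_smul, SmallSubProp.ev_ofMem]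
    cases a with
    | none =>
      refine Eq.trans ?_ hx.symm
      change ((P.op m n).d (k + 1 + 1) (k + 1)).hom (c • 0) = 0
      rw [smul_zero, map_zero]
    | some f =>
      -- As the base component is zero, this says that the operation vanishes on the image of `i`,
      -- as `homD_twContract` requires.
      have hi := intertwines_twIncl_of_mem hmem f
      rw [hbase, map_zero] at hi
      have hd' : homD (tw (Alg.arrowHom f)) m n rfl (twAt f y) = 0 := by
        rw [← endProp_d]
        refine ((twSubProp P).ev_d (some f) (k + 1) k x).symm.trans ?_
        rw [hd]
        exact map_zero ((twSubProp P).ev (some f))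
      -- On the kernel the subtracted lift is the lift of zero, so the operator is the plain
      -- contraction.
      have ht : twAt f (twUnary y) = twContract (Alg.arrowHom f) (twAt f y) := by
        change twContract (Alg.arrowHom f) (twAt f y - twOp (Alg.arrowHom f)
          (f.left.actDeg (twBase y)) (f.right.actDeg (twBase y))) = _
        rw [hbase, map_zero, map_zero, twOp_zero]
        exact congrArg (twContract _) (Subtype.ext (sub_zero (twAt f y).1))
      change (((endProp (tw (Alg.arrowHom f))).op m n).d (k + 1 + 1) (k + 1)).hom
        (c • twAt f (twUnary y)) = twAt f y
      rw [ht]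
      refine (endProp_d (tw (Alg.arrowHom f)) rfl
        (c • twContract (Alg.arrowHom f) (twAt f y))).trans ?_
      rw [map_smul, homD_twContract rfl hi hd', sg_smul_sg, negOnePow_mul_self_eq_one, sg_one,
        one_smul]

variable {P} (ψ : P ⟶ (twSubProp P).toDGProp)

/-- The family of operations associated to an operation of `P` by a morphism from `P`. -/
noncomputable def liftFamily {m n : ℕ} {k : ℤ} (p : (P.op m n).X k) :
    OpFamily (twProps P) m n k :=
  fun a => (twSubProp P).ev a (((DGProp.Hom.app ψ m n).f k).hom p)

theorem liftFamily_mem {m n : ℕ} {k : ℤ} (p : (P.op m n).X k) :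
    liftFamily ψ p ∈ (twSubProp P).S m n k :=
  SmallSubProp.ev_mem _

/-- The algebra structure on the twisted sum. -/
noncomputable def twAlg (f : Arrow (Alg P)) : Alg P where
  X := tw (Alg.arrowHom f)
  str := ψ ≫ (twSubProp P).proj (some f)

/-- The functor from arrows of algebras to algebras given by the twisted sums. -/
noncomputable def twAlgFunctor : Arrow (Alg P) ⥤ Alg P where
  obj := twAlg ψ
  map {f g} φ := Alg.Hom.mk (A := twAlg ψ f) (B := twAlg ψ g) (twMap _ _ _ _ (Alg.arrow_w φ))
    fun p => intertwines_twMap_of_mem (liftFamily_mem ψ p) φ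
  map_id _ := rfl
  map_comp _ _ := rfl

variable {ψ}

/-- Being a section identifies the base component of the lifted family with the given operation.
Compatibility with that component then becomes compatibility with the original algebra structures.
-/
theorem twBase_liftFamily (hψ : ψ ≫ (twSubProp P).proj none = 𝟙 P) {m n : ℕ}
    {k : ℤ} (p : (P.op m n).X k) :
    twBase (liftFamily ψ p) = p :=
  congrArg (fun φ : P ⟶ P => ((DGProp.Hom.app φ m n).f k).hom p) hψ

/-- The maps `i` are morphisms of algebras. -/
noncomputable def twAlgI (hψ : ψ ≫ (twSubProp P).proj none = 𝟙 P) :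
    Arrow.leftFunc ⟶ twAlgFunctor ψ where
  app f := Alg.Hom.mk (A := f.left) (B := twAlg ψ f) (twIncl (Alg.arrowHom f)) fun p => by
    have := intertwines_twIncl_of_mem (liftFamily_mem ψ p) f
    rw [twBase_liftFamily hψ] at this
    exact this
  naturality f g φ := Alg.Hom.ext ((twI K).naturality ((Alg.forget P).mapArrow.map φ))

/-- The maps `p` are morphisms of algebras. -/
noncomputable def twAlgP (hψ : ψ ≫ (twSubProp P).proj none = 𝟙 P) :
    twAlgFunctor ψ ⟶ Arrow.rightFunc where
  app f := Alg.Hom.mk (A := twAlg ψ f) (B := f.right) (twProj (Alg.arrowHom f)) fun p => by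
    have := intertwines_twProj_of_mem (liftFamily_mem ψ p) f
    rw [twBase_liftFamily hψ] at this
    exact this
  naturality f g φ := Alg.Hom.ext ((twP K).naturality ((Alg.forget P).mapArrow.map φ))

/-- The maps `s` are morphisms of algebras if all operations with inputs have outputs. -/
noncomputable def twAlgS (hψ : ψ ≫ (twSubProp P).proj none = 𝟙 P)
    (hP : P.NonemptyOutputs) : twAlgFunctor ψ ⟶ Arrow.leftFunc where
  app f := Alg.Hom.mk (A := twAlg ψ f) (B := f.left) (twFst (Alg.arrowHom f)) fun p => by
    have := intertwines_twFst_of_mem (liftFamily_mem ψ p) hP f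
    rw [twBase_liftFamily hψ] at this
    exact this
  naturality f g φ := Alg.Hom.ext ((twS K).naturality ((Alg.forget P).mapArrow.map φ))

/-- The functorial factorization of morphisms of algebras. -/
noncomputable def twAlgFactorization (hψ : ψ ≫ (twSubProp P).proj none = 𝟙 P) :
    (Alg.acyclicInjections P).FunctorialFactorizationData (Alg.surjections P) where
  Z := twAlgFunctor ψ
  i := twAlgI hψ
  p := twAlgP hψ
  fac := rfl
  hi _ := ⟨fun _ _ _ h => congrArg Prod.fst h, quasiIso_twIncl _⟩
  hp _ := fun _ y => ⟨(0, 0, y), rfl⟩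

end Main
end DG

theorem theorem2p8 {K : Type u} [Field K] (P : DG.DGProp K) (hP : P.IsCofibrant) :
    ∃ (F : (DG.Alg.acyclicInjections P).FunctorialFactorizationData (DG.Alg.surjections P))
      (hZ : F.Z ⋙ DG.Alg.forget P = (DG.Alg.forget P).mapArrow ⋙ DG.twFunctor K),
      Functor.whiskerRight F.i (DG.Alg.forget P) ≫ eqToHom hZ =
        Functor.whiskerLeft (DG.Alg.forget P).mapArrow (DG.twI K) ∧
      Functor.whiskerRight F.p (DG.Alg.forget P) =
        eqToHom hZ ≫ Functor.whiskerLeft (DG.Alg.forget P).mapArrow (DG.twP K) ∧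
      (P.NonemptyOutputs → ∃ s : F.Z ⟶ Arrow.leftFunc,
        Functor.whiskerRight s (DG.Alg.forget P) =
          eqToHom hZ ≫ Functor.whiskerLeft (DG.Alg.forget P).mapArrow (DG.twS K)) := by
  -- Lifting the identity of `P` through the acyclic fibration yields the section, hence all the
  -- algebra structures at once.
  obtain ⟨ψ, hψ⟩ := hP _ (DG.twProj_mem_acyclicFibrations P) (𝟙 P)
  -- The algebra structures are put on the complexes `tw` themselves, with unchanged underlying
  -- maps, so the comparisons with `Z`, `i`, `p` and `s` hold by definition.
  exact ⟨DG.twAlgFactorization hψ, rfl, rfl, rfl, fun h => ⟨DG.twAlgS hψ h, rfl⟩⟩
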